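/- **Definitions.** Let $X\subseteq\{0,1\}^n$ and let $f\colon X\to\{0,1\}$ be a partial Boolean function on $n$ bits. A (deterministic) decision tree queries input bits adaptively and outputs a bit; $\mathrm{cost}(D(x))$ is the number of queries that the tree $D$ makes on input $x$. A randomized algorithm $R$ is a probability distribution over decision trees. For a success probability $\gamma\in[0,1]$, the *average-case query complexity* of $f$ is $$\overline{\mathrm R}_\gamma(f)=\min_{R}\ \max_{x\in X}\ \mathbb E_{D\sim R}[\mathrm{cost}(D(x))],$$ where the minimum is over all $R$ with $\Pr_{D\sim R}[D(x)=f(x)]\ge\gamma$ for every $x\in X$. The *maximum distributional query complexity* of $f$ is $$\overline{\overline{\mathrm R}}_\gamma(f)=\max_{\mu}\ \min_{R}\ \mathbb E_{x\sim\mu,\,D\sim R}[\mathrm{cost}(D(x))],$$ where $\mu$ ranges over the probability distributions on $X$ and, for given $\mu$, the minimum is over all $R$ with $\Pr_{x\sim\mu,\,D\sim R}[D(x)=f(x)]\ge\gamma$. **Proposition (separation of maximum distributional and average-case complexity).** There are absolute constants $C,c>0$ such that for every $n\ge 1$ and every $\delta$ with $n^{-c}\le\delta\le 1$ there are a set $X\subseteq\{0,1\}^n$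 and a non-constant partial function $f\colon X\to\{0,1\}$ with $$\overline{\overline{\mathrm R}}_{\frac{1+\delta}{2}}(f)\ \le\ C\,\delta^{1/6}\;\overline{\mathrm R}_{\frac{1+\delta}{2}}(f).$$ In particular, for every fixed $\delta\in(0,1]$, and for every $\delta=\delta(n)\in(0,1]$ that vanishes at most as fast as $n^{-c}$, such an $f$ exists for infinitely many (indeed all sufficiently large) $n$, so that in the small-advantage regime the maximum distributional complexity can be smaller than the average-case complexity by a polynomial factor in $\delta$. -/

import Mathlib

open scoped ENNReal

/-- Deterministic query algorithms on `n`-bit inputs: a leaf carries the output bit, and an internal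
node queries one coordinate and continues in its first subtree if the bit read is `false` (`0`), in
its second subtree if it is `true` (`1`). -/
inductive DecisionTree (n : ℕ) : Type
  | leaf (b : Bool) : DecisionTree n
  | query (i : Fin n) (t₀ t₁ : DecisionTree n) : DecisionTree n

namespace DecisionTree

/-- The output of the tree on input `x`. -/
def eval {n : ℕ} : DecisionTree n → (Fin n → Bool) → Bool
  | leaf b, _ => b
  | query i t₀ t₁, x => if x i then t₁.eval x else t₀.eval x

/-- The cost on input `x`: the depth of the leaf reached by `x`, i.e. the number of queries made. -/
def cost {n : ℕ} : DecisionTree n → (Fin n → Bool) → ℕ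
  | leaf _, _ => 0
  | query i t₀ t₁, x => (if x i then t₁.cost x else t₀.cost x) + 1

end DecisionTree

/-- A randomized query algorithm is a probability distribution over decision trees. -/
abbrev RandomizedAlgorithm (n : ℕ) : Type := PMF (DecisionTree n)

namespace RandomizedAlgorithm

variable {n : ℕ}

/-- The probability, over the randomness of `R`, that `R` outputs `b` on input `x`. -/
noncomputable def outputProb (R : RandomizedAlgorithm n) (x : Fin n → Bool) (b : Bool) : ℝ≥0∞ :=
  ∑' D : DecisionTree n, R D * (if D.eval x = b then 1 else 0)

/-- The expected number of queries, over the randomness of `R`, that `R` makes on input `x`. -/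
noncomputable def expectedCost (R : RandomizedAlgorithm n) (x : Fin n → Bool) : ℝ≥0∞ :=
  ∑' D : DecisionTree n, R D * (D.cost x : ℝ≥0∞)

variable {X : Set (Fin n → Bool)}

/-- `min_{x ∈ X} Pr_{D ∼ R}[D(x) = f(x)]`, for a partial function `f` with domain `X`. -/
noncomputable def worstSuccess (R : RandomizedAlgorithm n) (f : X → Bool) : ℝ≥0∞ :=
  ⨅ x : X, R.outputProb x (f x)

/-- `max_{x ∈ X} E_{D ∼ R}[cost(D(x))]`. -/
noncomputable def worstExpectedCost (R : RandomizedAlgorithm n) (X : Set (Fin n → Bool)) : ℝ≥0∞ :=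
  ⨆ x : X, R.expectedCost x

/-- `Pr_{x ∼ μ, D ∼ R}[D(x) = f(x)]`, for a distribution `μ` on the domain `X` of `f`. -/
noncomputable def distSuccess (R : RandomizedAlgorithm n) (f : X → Bool) (μ : PMF X) : ℝ≥0∞ :=
  ∑' x : X, μ x * R.outputProb x (f x)

/-- `E_{x ∼ μ, D ∼ R}[cost(D(x))]`. -/
noncomputable def distCost (R : RandomizedAlgorithm n) (μ : PMF X) : ℝ≥0∞ :=
  ∑' x : X, μ x * R.expectedCost x

end RandomizedAlgorithm

/-- Average-case query complexity of the partial function `f` with success probability `γ`: the least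
worst-case (over inputs in `X`) expected cost of a randomized algorithm that computes `f` with
probability at least `γ` on every input in `X`. -/
noncomputable def averageCaseComplexity {n : ℕ} {X : Set (Fin n → Bool)} (f : X → Bool) (γ : ℝ) :
    ℝ≥0∞ :=
  ⨅ (R : RandomizedAlgorithm n) (_ : ENNReal.ofReal γ ≤ R.worstSuccess f), R.worstExpectedCost X

/-- Distributional query complexity of `f` for the input distribution `μ`: both the success
probability and the cost are averaged over `x ∼ μ` and over the randomness of the algorithm. -/
noncomputable def distributionalComplexity {n : ℕ} {X : Set (Fin n → Bool)} (f : X → Bool) (γ : ℝ)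
    (μ : PMF X) : ℝ≥0∞ :=
  ⨅ (R : RandomizedAlgorithm n) (_ : ENNReal.ofReal γ ≤ R.distSuccess f μ), R.distCost μ

/-- Maximum distributional query complexity of `f`: the maximum of the distributional complexity
over all distributions on the domain of `f`. -/
noncomputable def maxDistributionalComplexity {n : ℕ} {X : Set (Fin n → Bool)} (f : X → Bool)
    (γ : ℝ) : ℝ≥0∞ :=
  ⨆ μ : PMF X, distributionalComplexity f γ μ

/-!
The hard function looks at three blocks of bits. If no flag is raised, it asks whether the signs are
biased towards `true`; otherwise it asks whether some mark is set.

For a known input distribution, a bounded expected number of queries gains advantage `d`. If the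
mean rate of raised flags is at least `d`, then a random flag is queried just often enough for the
advantage to be `d`, and the marks are searched when it is raised. If that rate is smaller, then
either a quarter of the mass lies on unflagged inputs with biased signs, where a single random sign
already gains a constant times `d`, or the answer is mostly `false`.

In the worst case, an algorithm with `T` expected queries must raise its acceptance probability by
`d` when the sign bias moves from `0` to a constant times `d`. The acceptance probability of a
bounded number of queries has small second differences. Acceptance after many queries is rare, and
by Cauchy–Schwarz the shift changes its probability only slightly. Hence the increment is almost the
same on flagged inputs, and `k` such increments raise the acceptance probability there by at least
`k * d / 2`. The answer is `false` throughout as long as no mark is set, so at the start the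
algorithm accepts with probability below `1 / 2 - k * d / 2`, up to small errors, yet setting any
single one of the `1 / d` marks must lift this above `1 / 2`. Each mark is then queried with
probability of order `k * d`, so `T` is at least of order `k`. The errors stay small for `T` up to a
constant times `d ^ (-1 / 6)`. When `d` is not small, reading one bit suffices.
-/
section WeightedMean

variable {α : Type*} [Fintype α] {w : α → ℝ} {F G : α → ℝ}

/-- The mean `∑ x, w x * F x` of `F` under the weights `w`, as a linear functional of `F`. It is an
expectation when `w ∈ stdSimplex ℝ α`. -/
def weightedMean (w : α → ℝ) : (α → ℝ) →ₗ[ℝ] ℝ :=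
  ∑ x, w x • LinearMap.proj x

lemma weightedMean_apply (w F : α → ℝ) : weightedMean w F = ∑ x, w x * F x := by
  simp [weightedMean]

lemma weightedMean_congr (h : ∀ x, w x ≠ 0 → F x = G x) : weightedMean w F = weightedMean w G := by
  simp only [weightedMean_apply]
  refine Finset.sum_congr rfl fun x _ => ?_
  by_cases hx : w x = 0
  · simp [hx]
  · rw [h x hx]

lemma weightedMean_mono (hw : w ∈ stdSimplex ℝ α) (h : ∀ x, w x ≠ 0 → F x ≤ G x) :
    weightedMean w F ≤ weightedMean w G := by
  simp only [weightedMean_apply]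
  refine Finset.sum_le_sum fun x _ => ?_
  by_cases hx : w x = 0
  · simp [hx]
  · exact mul_le_mul_of_nonneg_left (h x hx) (hw.1 x)

lemma weightedMean_const (hw : w ∈ stdSimplex ℝ α) (c : ℝ) : weightedMean w (fun _ => c) = c := by
  rw [weightedMean_apply, ← Finset.sum_mul, hw.2, one_mul]

lemma weightedMean_nonneg (hw : w ∈ stdSimplex ℝ α) (h : ∀ x, 0 ≤ F x) : 0 ≤ weightedMean w F := by
  rw [weightedMean_apply]
  exact Finset.sum_nonneg fun x _ => mul_nonneg (hw.1 x) (h x)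

lemma weightedMean_le (hw : w ∈ stdSimplex ℝ α) {u : ℝ} (h : ∀ x, F x ≤ u) :
    weightedMean w F ≤ u :=
  (weightedMean_mono hw fun x _ => h x).trans_eq (weightedMean_const hw u)

lemma weightedMean_le_add (hw : w ∈ stdSimplex ℝ α) {E : Set α} {u C : ℝ}
    (h : ∀ x ∉ E, w x ≠ 0 → F x ≤ u) (hE : ∀ x, F x ≤ u + C) :
    weightedMean w F ≤ u + C * weightedMean w (E.indicator 1) := by
  calc weightedMean w F ≤ weightedMean w ((fun _ => u) + C • E.indicator 1) := by
        refine weightedMean_mono hw fun x hx => ?_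
        by_cases hxE : x ∈ E
        · simpa [hxE] using hE x
        · simpa [hxE] using h x hxE hx
    _ = u + C * weightedMean w (E.indicator 1) := by
        rw [map_add, map_smul, weightedMean_const hw, smul_eq_mul]

lemma sub_le_weightedMean (hw : w ∈ stdSimplex ℝ α) {E : Set α} {l C : ℝ}
    (h : ∀ x ∉ E, w x ≠ 0 → l ≤ F x) (hE : ∀ x, l - C ≤ F x) :
    l - C * weightedMean w (E.indicator 1) ≤ weightedMean w F := by
  have hneg := weightedMean_le_add (F := -F) (u := -l) (C := C) hw
    (fun x hx hwx => neg_le_neg (h x hx hwx))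
    (fun x => by simp only [Pi.neg_apply]; linarith [hE x])
  rw [map_neg] at hneg
  linarith

end WeightedMean

section RandomBits

variable {ι : Type*} {θ : ι → ℝ} {x : ι → Bool} {i : ι}

lemma update_mem_Icc_zero_one [DecidableEq ι] (hθ : θ ∈ Set.Icc 0 1) (i : ι) {c : ℝ}
    (hc : c ∈ Set.Icc (0 : ℝ) 1) :
    Function.update θ i c ∈ Set.Icc 0 1 :=
  ⟨le_update_iff.2 ⟨hc.1, fun j _ => hθ.1 j⟩, update_le_iff.2 ⟨hc.2, fun j _ => hθ.2 j⟩⟩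

variable [Fintype ι]

/-- The probability of the outcome `x` when the bits are independent and bit `i` is `true` with
probability `θ i`. -/
def bitWeight (θ : ι → ℝ) (x : ι → Bool) : ℝ := ∏ i, if x i then θ i else 1 - θ i

lemma apply_eq_false_of_bitWeight_ne_zero (hx : bitWeight θ x ≠ 0) (hi : θ i = 0) :
    x i = false := by
  contrapose! hx
  exact Finset.prod_eq_zero (Finset.mem_univ i) (by simp [hi, hx])

lemma apply_eq_true_of_bitWeight_ne_zero (hx : bitWeight θ x ≠ 0) (hi : θ i = 1) : x i = true := by
  contrapose! hx
  exact Finset.prod_eq_zero (Finset.mem_univ i) (by simp [hi, hx])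

variable [DecidableEq ι]

/-- The expectation over independent bits, where bit `i` is `true` with probability `θ i`. -/
def bitMean (θ : ι → ℝ) : ((ι → Bool) → ℝ) →ₗ[ℝ] ℝ := weightedMean (bitWeight θ)

lemma bitMean_prod (θ : ι → ℝ) (g : ι → Bool → ℝ) :
    bitMean θ (fun x => ∏ i, g i (x i)) = ∏ i, ((1 - θ i) * g i false + θ i * g i true) := by
  have hfactor (i : ι) : (1 - θ i) * g i false + θ i * g i true
      = ∑ b : Bool, (if b then θ i else 1 - θ i) * g i b := by
    simp [add_comm]
  simp only [bitMean, weightedMean_apply, bitWeight, ← Finset.prod_mul_distrib, hfactor,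
    Fintype.prod_sum]

lemma bitWeight_mem_stdSimplex (hθ : θ ∈ Set.Icc 0 1) : bitWeight θ ∈ stdSimplex ℝ (ι → Bool) := by
  refine ⟨fun x => Finset.prod_nonneg fun i _ => ?_, ?_⟩
  · split_ifs
    · exact hθ.1 i
    · exact sub_nonneg.2 (hθ.2 i)
  · simpa [bitMean, weightedMean_apply] using bitMean_prod θ fun _ _ => 1

lemma bitWeight_update (θ : ι → ℝ) (i : ι) (c : ℝ) (x : ι → Bool) :
    bitWeight (Function.update θ i c) x
      = (if x i then c else 1 - c) * ∏ j ∈ Finset.univ.erase i, if x j then θ j else 1 - θ j := by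
  rw [bitWeight, ← Finset.mul_prod_erase _ _ (Finset.mem_univ i), Function.update_self]
  congr 1
  refine Finset.prod_congr rfl fun j hj => ?_
  rw [Function.update_of_ne (Finset.ne_of_mem_erase hj)]

lemma bitMean_eq_condition (θ : ι → ℝ) (i : ι) (F : (ι → Bool) → ℝ) :
    bitMean θ F = (1 - θ i) * bitMean (Function.update θ i 0) F
      + θ i * bitMean (Function.update θ i 1) F := by
  simp only [bitMean, weightedMean_apply, Finset.mul_sum, ← Finset.sum_add_distrib]
  refine Finset.sum_congr rfl fun x _ => ?_
  rw [bitWeight_update, bitWeight_update]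
  nth_rewrite 1 [← Function.update_eq_self i θ]
  rw [bitWeight_update]
  split_ifs <;> ring

lemma bitMean_ite (θ : ι → ℝ) (i : ι) (F G : (ι → Bool) → ℝ) :
    bitMean θ (fun x => if x i then G x else F x)
      = (1 - θ i) * bitMean (Function.update θ i 0) F
        + θ i * bitMean (Function.update θ i 1) G := by
  rw [bitMean_eq_condition θ i]
  congr 2
  · refine weightedMean_congr fun x hx => ?_
    rw [apply_eq_false_of_bitWeight_ne_zero hx (Function.update_self ..)]
    exact if_neg Bool.false_ne_true
  · refine weightedMean_congr fun x hx => ?_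
    rw [apply_eq_true_of_bitWeight_ne_zero hx (Function.update_self ..)]
    exact if_pos rfl

lemma bitMean_centered_mul_centered (θ : ι → ℝ) (i j : ι) :
    bitMean θ (fun x => ((x i).toNat - θ i) * ((x j).toNat - θ j))
      = if i = j then θ i * (1 - θ i) else 0 := by
  have hprod : (fun x : ι → Bool => ((x i).toNat - θ i) * ((x j).toNat - θ j))
      = fun x => ∏ k, (if k = i then ((x k).toNat - θ k : ℝ) else 1)
          * (if k = j then ((x k).toNat - θ k : ℝ) else 1) := by
    ext x
    rw [Finset.prod_mul_distrib, Finset.prod_ite_eq' Finset.univ i fun k => ((x k).toNat - θ k : ℝ),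
      Finset.prod_ite_eq' Finset.univ j fun k => ((x k).toNat - θ k : ℝ)]
    simp only [Finset.mem_univ, if_true]
  rw [hprod, bitMean_prod θ fun k b => (if k = i then (b.toNat - θ k : ℝ) else 1)
    * (if k = j then (b.toNat - θ k : ℝ) else 1)]
  split_ifs with hij
  · subst hij
    rw [Finset.prod_eq_single i (fun k _ hk => by simp [hk]) (by simp)]
    simp only [if_true, Bool.toNat_true, Bool.toNat_false, Nat.cast_zero, Nat.cast_one]
    ring
  · refine Finset.prod_eq_zero (Finset.mem_univ i) ?_
    simp only [if_true, if_neg hij, Bool.toNat_true, Bool.toNat_false, Nat.cast_zero, Nat.cast_one]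
    ring

lemma bitMean_sum_centered_sq_le (θ : ι → ℝ) (S : Finset ι) :
    bitMean θ (fun x => (∑ i ∈ S, ((x i).toNat - θ i)) ^ 2) ≤ S.card / 4 := by
  have hexpand : (fun x : ι → Bool => (∑ i ∈ S, ((x i).toNat - θ i)) ^ 2)
      = ∑ i ∈ S, ∑ j ∈ S, fun x : ι → Bool => ((x i).toNat - θ i) * ((x j).toNat - θ j) := by
    ext x
    simp only [sq, Finset.sum_mul_sum, Finset.sum_apply]
  simp only [hexpand, map_sum, bitMean_centered_mul_centered]
  calc ∑ i ∈ S, ∑ j ∈ S, (if i = j then θ i * (1 - θ i) else 0)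
      = ∑ i ∈ S, θ i * (1 - θ i) := Finset.sum_congr rfl fun i hi => by simp [hi]
    _ ≤ ∑ _i ∈ S, (1 / 4 : ℝ) := Finset.sum_le_sum fun i _ => by nlinarith [sq_nonneg (θ i - 1 / 2)]
    _ = S.card / 4 := by simp [div_eq_mul_inv]

/-- The fraction of the bits in `S` that are `true`. -/
noncomputable def bitAvg (S : Finset ι) (x : ι → Bool) : ℝ := (∑ i ∈ S, ((x i).toNat : ℝ)) / S.card

lemma bitMean_abs_bitAvg_sub_ge_le (hθ : θ ∈ Set.Icc 0 1) {S : Finset ι} (hS : S.Nonempty)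
    {q s : ℝ} (hq : ∀ i ∈ S, θ i = q) (hs : 0 < s) :
    bitMean θ ({x | s ≤ |bitAvg S x - q|}.indicator 1) ≤ 1 / (4 * s ^ 2 * S.card) := by
  have hcard : (0 : ℝ) < S.card := by exact_mod_cast hS.card_pos
  have hsum (x : ι → Bool) : ∑ i ∈ S, ((x i).toNat - θ i) = S.card * (bitAvg S x - q) := by
    rw [bitAvg, Finset.sum_sub_distrib, Finset.sum_congr rfl hq, Finset.sum_const, nsmul_eq_mul]
    field_simp
  have hvar := bitMean_sum_centered_sq_le θ S
  have hmarkov : bitMean θ ((s * S.card) ^ 2 • {x | s ≤ |bitAvg S x - q|}.indicator 1)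
      ≤ bitMean θ (fun x => (∑ i ∈ S, ((x i).toNat - θ i)) ^ 2) := by
    refine weightedMean_mono (bitWeight_mem_stdSimplex hθ) fun x _ => ?_
    rw [hsum, Pi.smul_apply, smul_eq_mul]
    rcases le_or_gt s |bitAvg S x - q| with hx | hx
    · have hmem : x ∈ {x | s ≤ |bitAvg S x - q|} := hx
      rw [Set.indicator_of_mem hmem, Pi.one_apply, mul_one, mul_pow, mul_pow, mul_comm (s ^ 2),
        ← sq_abs (bitAvg S x - q)]
      gcongr
    · have hmem : x ∉ {x | s ≤ |bitAvg S x - q|} := hx.not_ge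
      rw [Set.indicator_of_notMem hmem, mul_zero]
      positivity
  rw [map_smul, smul_eq_mul] at hmarkov
  rw [le_div_iff₀ (by positivity)]
  nlinarith [hmarkov.trans hvar]

end RandomBits

lemma mul_mul_sub_mul_le_div {a b p α e x y : ℝ} (ha : a ∈ Set.Icc (0 : ℝ) 1)
    (hab : (b - a) ^ 2 ≤ p ^ 2 * (a * (1 - a))) (hα : 0 < α) (hα1 : α ≤ 1) (he : |e| ≤ 1)
    (hx : x ∈ Set.Icc (0 : ℝ) 1) (hy : y ∈ Set.Icc (0 : ℝ) 1) :
    (b - a) * (y - x) * (e + α * (1 - x - y)) - α * (a * (1 - a)) * (y - x) ^ 2 ≤ p ^ 2 / α := by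
  set g := e + α * (1 - x - y)
  set h := (b - a) * g
  set v := a * (1 - a)
  have hxy : |1 - x - y| ≤ 1 := abs_le.2 ⟨by linarith [hx.2, hy.2], by linarith [hx.1, hy.1]⟩
  have hg : |g| ≤ |(2 : ℝ)| := by
    calc |g| ≤ |e| + α * |1 - x - y| := by
          refine (abs_add_le _ _).trans_eq ?_
          rw [abs_mul, abs_of_pos hα]
      _ ≤ 1 + 1 * 1 := by gcongr
      _ = |(2 : ℝ)| := by norm_num
  have hv : 0 ≤ v := mul_nonneg ha.1 (sub_nonneg.2 ha.2)
  have hh : h ^ 2 ≤ 4 * p ^ 2 * v := by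
    calc h ^ 2 = (b - a) ^ 2 * g ^ 2 := mul_pow _ _ _
      _ ≤ p ^ 2 * v * 2 ^ 2 := mul_le_mul hab (sq_le_sq.2 hg) (sq_nonneg _) (by positivity)
      _ = 4 * p ^ 2 * v := by ring
  rw [le_div_iff₀ hα]
  obtain hv0 | hv0 := hv.eq_or_lt
  · have hh0 : h = 0 := by
      rw [← hv0, mul_zero] at hh
      exact pow_eq_zero_iff two_ne_zero |>.1 (le_antisymm hh (sq_nonneg h))
    calc _ = h * ((y - x) * α) - α ^ 2 * v * (y - x) ^ 2 := by ring
      _ = 0 := by rw [hh0, ← hv0]; ring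
      _ ≤ p ^ 2 := sq_nonneg p
  · refine le_of_mul_le_mul_left ?_ (mul_pos four_pos hv0)
    linear_combination hh + sq_nonneg (h - 2 * v * (α * (y - x)))

namespace DecisionTree

section AcceptProb

variable {n : ℕ} {θ θ' : Fin n → ℝ}

/-- The indicator function of the inputs on which the tree outputs `true`. -/
def accept (t : DecisionTree n) (x : Fin n → Bool) : ℝ := (t.eval x).toNat

/-- The probability that the tree outputs `true` on independent bits with biases `θ`. -/
def acceptProb (θ : Fin n → ℝ) (t : DecisionTree n) : ℝ := bitMean θ t.accept

/-- The expected number of queries of the tree on independent bits with biases `θ`. -/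
def meanCost (θ : Fin n → ℝ) (t : DecisionTree n) : ℝ := bitMean θ fun x => t.cost x

lemma accept_nonneg (t : DecisionTree n) (x : Fin n → Bool) : 0 ≤ t.accept x := Nat.cast_nonneg _

lemma accept_le_one (t : DecisionTree n) (x : Fin n → Bool) : t.accept x ≤ 1 := by
  rw [accept]
  exact_mod_cast (t.eval x).toNat_le

lemma acceptProb_nonneg (hθ : θ ∈ Set.Icc 0 1) (t : DecisionTree n) : 0 ≤ t.acceptProb θ :=
  weightedMean_nonneg (bitWeight_mem_stdSimplex hθ) t.accept_nonneg

lemma acceptProb_le_one (hθ : θ ∈ Set.Icc 0 1) (t : DecisionTree n) : t.acceptProb θ ≤ 1 :=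
  weightedMean_le (bitWeight_mem_stdSimplex hθ) t.accept_le_one

lemma meanCost_nonneg (hθ : θ ∈ Set.Icc 0 1) (t : DecisionTree n) : 0 ≤ t.meanCost θ :=
  weightedMean_nonneg (bitWeight_mem_stdSimplex hθ) fun _ => Nat.cast_nonneg _

lemma acceptProb_leaf (hθ : θ ∈ Set.Icc 0 1) (b : Bool) :
    (leaf b : DecisionTree n).acceptProb θ = b.toNat :=
  weightedMean_const (bitWeight_mem_stdSimplex hθ) (b.toNat : ℝ)

lemma acceptProb_query (θ : Fin n → ℝ) (i : Fin n) (t₀ t₁ : DecisionTree n) :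
    (query i t₀ t₁).acceptProb θ
      = (1 - θ i) * t₀.acceptProb (Function.update θ i 0)
        + θ i * t₁.acceptProb (Function.update θ i 1) := by
  rw [acceptProb, acceptProb, acceptProb, ← bitMean_ite]
  congr 1
  ext x
  simp only [accept, eval]
  split_ifs <;> rfl

lemma meanCost_query (hθ : θ ∈ Set.Icc 0 1) (i : Fin n) (t₀ t₁ : DecisionTree n) :
    (query i t₀ t₁).meanCost θ
      = (1 - θ i) * t₀.meanCost (Function.update θ i 0)
        + θ i * t₁.meanCost (Function.update θ i 1) + 1 := by
  rw [meanCost, meanCost, meanCost, ← bitMean_ite]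
  have hone : bitMean θ (fun _ => 1) = 1 := weightedMean_const (bitWeight_mem_stdSimplex hθ) 1
  refine Eq.trans ?_ (congrArg _ hone)
  rw [← map_add]
  congr 1
  ext x
  simp only [cost, Pi.add_apply]
  split_ifs <;> push_cast <;> rfl

lemma abs_acceptProb_query_update_one_sub_le (hθ : θ ∈ Set.Icc 0 1) (i j : Fin n)
    (t₀ t₁ : DecisionTree n) :
    |(query i t₀ t₁).acceptProb (Function.update θ j 1) - (query i t₀ t₁).acceptProb θ|
      ≤ (1 - θ i) * |t₀.acceptProb (Function.update (Function.update θ i 0) j 1)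
            - t₀.acceptProb (Function.update θ i 0)|
        + θ i * |t₁.acceptProb (Function.update (Function.update θ i 1) j 1)
            - t₁.acceptProb (Function.update θ i 1)|
        + if j = i then 1 else 0 := by
  have hi0 : 0 ≤ 1 - θ i := sub_nonneg.2 (hθ.2 i)
  have hi1 : 0 ≤ θ i := hθ.1 i
  rw [acceptProb_query, acceptProb_query]
  split_ifs with hji
  · subst hji
    have hθ₀ := update_mem_Icc_zero_one hθ j unitInterval.zero_mem
    have hθ₁ := update_mem_Icc_zero_one hθ j unitInterval.one_mem
    have hle₀ := acceptProb_le_one hθ₀ t₀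
    have hnonneg₀ := acceptProb_nonneg hθ₀ t₀
    have hle₁ := acceptProb_le_one hθ₁ t₁
    have hnonneg₁ := acceptProb_nonneg hθ₁ t₁
    simp only [Function.update_idem, Function.update_self, sub_self, abs_zero, mul_zero]
    refine le_add_of_nonneg_of_le (by positivity) (abs_le.2 ⟨?_, ?_⟩) <;> nlinarith
  · rw [Function.update_of_ne (Ne.symm hji), Function.update_comm hji, Function.update_comm hji,
      add_zero, add_sub_add_comm, ← mul_sub, ← mul_sub]
    refine (abs_add_le _ _).trans_eq ?_
    rw [abs_mul, abs_mul, abs_of_nonneg hi0, abs_of_nonneg hi1]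

lemma sum_abs_acceptProb_update_one_sub_le (hθ : θ ∈ Set.Icc 0 1) (J : Finset (Fin n))
    (t : DecisionTree n) :
    ∑ j ∈ J, |t.acceptProb (Function.update θ j 1) - t.acceptProb θ| ≤ t.meanCost θ := by
  induction t generalizing θ with
  | leaf b =>
    have hleaf (j : Fin n) := acceptProb_leaf (update_mem_Icc_zero_one hθ j unitInterval.one_mem) b
    simp only [hleaf, acceptProb_leaf hθ, sub_self, abs_zero, Finset.sum_const_zero]
    exact meanCost_nonneg hθ _
  | query i t₀ t₁ ih₀ ih₁ =>
    refine (Finset.sum_le_sum fun j _ =>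
      abs_acceptProb_query_update_one_sub_le hθ i j t₀ t₁).trans ?_
    rw [Finset.sum_add_distrib, Finset.sum_add_distrib, ← Finset.mul_sum, ← Finset.mul_sum,
      Finset.sum_ite_eq', meanCost_query hθ]
    gcongr
    · exact sub_nonneg.2 (hθ.2 i)
    · exact ih₀ (update_mem_Icc_zero_one hθ i unitInterval.zero_mem)
    · exact hθ.1 i
    · exact ih₁ (update_mem_Icc_zero_one hθ i unitInterval.one_mem)
    · split_ifs <;> norm_num

lemma mul_acceptProb_le_add (hθ : θ ∈ Set.Icc 0 1) (hθ' : θ' ∈ Set.Icc 0 1) {p α e : ℝ}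
    (h : ∀ i, (θ' i - θ i) ^ 2 ≤ p ^ 2 * (θ i * (1 - θ i))) (hα : 0 < α) (hα1 : α ≤ 1)
    (he : |e| ≤ 1) (t : DecisionTree n) :
    e * t.acceptProb θ' ≤ e * t.acceptProb θ + α * (t.acceptProb θ * (1 - t.acceptProb θ))
      + p ^ 2 / α * t.meanCost θ' := by
  induction t generalizing θ θ' with
  | leaf b =>
    have hacc := mul_nonneg (acceptProb_nonneg hθ (leaf b))
      (sub_nonneg.2 (acceptProb_le_one hθ (leaf b)))
    have hcost := meanCost_nonneg hθ' (leaf b)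
    rw [acceptProb_leaf hθ] at hacc ⊢
    rw [acceptProb_leaf hθ', add_assoc]
    exact le_add_of_nonneg_right
      (add_nonneg (mul_nonneg hα.le hacc) (mul_nonneg (div_nonneg (sq_nonneg p) hα.le) hcost))
  | query i t₀ t₁ ih₀ ih₁ =>
    have hθ₀ := update_mem_Icc_zero_one hθ i unitInterval.zero_mem
    have hθ₁ := update_mem_Icc_zero_one hθ i unitInterval.one_mem
    have hupdate {c : ℝ} (hc : c ∈ Set.Icc (0 : ℝ) 1) (j : Fin n) :
        (Function.update θ' i c j - Function.update θ i c j) ^ 2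
          ≤ p ^ 2 * (Function.update θ i c j * (1 - Function.update θ i c j)) := by
      obtain rfl | hj := eq_or_ne j i
      · simp only [Function.update_self, sub_self, zero_pow two_ne_zero]
        exact mul_nonneg (sq_nonneg p) (mul_nonneg hc.1 (sub_nonneg.2 hc.2))
      · simpa only [Function.update_of_ne hj] using h j
    have h₀ := ih₀ hθ₀ (update_mem_Icc_zero_one hθ' i unitInterval.zero_mem)
      (hupdate unitInterval.zero_mem)
    have h₁ := ih₁ hθ₁ (update_mem_Icc_zero_one hθ' i unitInterval.one_mem)
      (hupdate unitInterval.one_mem)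
    rw [acceptProb_query, acceptProb_query, meanCost_query hθ']
    have hmix := add_le_add (mul_le_mul_of_nonneg_left h₀ (sub_nonneg.2 (hθ'.2 i)))
      (mul_le_mul_of_nonneg_left h₁ (hθ'.1 i))
    have hstep := mul_mul_sub_mul_le_div ⟨hθ.1 i, hθ.2 i⟩ (h i) hα hα1 he
      ⟨acceptProb_nonneg hθ₀ t₀, acceptProb_le_one hθ₀ t₀⟩
      ⟨acceptProb_nonneg hθ₁ t₁, acceptProb_le_one hθ₁ t₁⟩
    simp only [Pi.one_apply] at hmix
    linear_combination hmix + hstep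

lemma abs_acceptProb_sub_le (hθ : θ ∈ Set.Icc 0 1) (hθ' : θ' ∈ Set.Icc 0 1) {p α : ℝ}
    (h : ∀ i, (θ' i - θ i) ^ 2 ≤ p ^ 2 * (θ i * (1 - θ i))) (hα : 0 < α) (hα1 : α ≤ 1)
    (t : DecisionTree n) :
    |t.acceptProb θ' - t.acceptProb θ| ≤ α * t.acceptProb θ + p ^ 2 / α * t.meanCost θ' := by
  have hup := mul_acceptProb_le_add hθ hθ' h hα hα1 (e := 1) (by norm_num) t
  have hdown := mul_acceptProb_le_add hθ hθ' h hα hα1 (e := -1) (by norm_num) t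
  have hsq := mul_nonneg hα.le (sq_nonneg (t.acceptProb θ))
  rw [abs_le]
  constructor <;> linarith

end AcceptProb

section Increments

lemma abs_one_sub_mul_add_mul_le {a u v B : ℝ} (ha : a ∈ Set.Icc (0 : ℝ) 1) (hu : |u| ≤ B)
    (hv : |v| ≤ B) : |(1 - a) * u + a * v| ≤ B := by
  have ha' : 0 ≤ 1 - a := sub_nonneg.2 ha.2
  calc |(1 - a) * u + a * v| ≤ (1 - a) * |u| + a * |v| := by
        refine (abs_add_le _ _).trans_eq ?_
        rw [abs_mul, abs_mul, abs_of_nonneg ha', abs_of_nonneg ha.1]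
    _ ≤ (1 - a) * B + a * B := by
        have := ha.1
        gcongr
    _ = B := by ring

variable {n : ℕ}

/-- The worst-case number of queries. -/
def depth : DecisionTree n → ℕ
  | leaf _ => 0
  | query _ t₀ t₁ => max t₀.depth t₁.depth + 1

lemma abs_update_zero_le {η : Fin n → ℝ} {ρ : ℝ} (h : ∀ j, |η j| ≤ ρ) (i j : Fin n) :
    |Function.update η i 0 j| ≤ ρ := by
  obtain rfl | hj := eq_or_ne j i
  · simpa using (abs_nonneg _).trans (h j)
  · simpa only [Function.update_of_ne hj] using h j

lemma update_add_eq_add_update_zero (ϑ η : Fin n → ℝ) (i : Fin n) (c : ℝ) :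
    Function.update (ϑ + η) i c = Function.update ϑ i c + Function.update η i 0 := by
  rw [← Function.update_add, add_zero]

lemma abs_acceptProb_add_sub_le {θ η : Fin n → ℝ} (hθ : θ ∈ Set.Icc 0 1)
    (hθη : θ + η ∈ Set.Icc 0 1) {ρ : ℝ} (hρ : ∀ i, |η i| ≤ ρ) (t : DecisionTree n) :
    |t.acceptProb (θ + η) - t.acceptProb θ| ≤ ρ * t.depth := by
  induction t generalizing θ η with
  | leaf b => simp [acceptProb_leaf hθ, acceptProb_leaf hθη, depth]
  | query i t₀ t₁ ih₀ ih₁ =>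
    have hρ0 : 0 ≤ ρ := (abs_nonneg _).trans (hρ i)
    have hθ₀ := update_mem_Icc_zero_one hθ i unitInterval.zero_mem
    have hθ₁ := update_mem_Icc_zero_one hθ i unitInterval.one_mem
    have hθη₀ := update_mem_Icc_zero_one hθη i unitInterval.zero_mem
    have hθη₁ := update_mem_Icc_zero_one hθη i unitInterval.one_mem
    simp only [acceptProb_query, update_add_eq_add_update_zero, Pi.add_apply] at hθη₀ hθη₁ ⊢
    set D : ℝ := max t₀.depth t₁.depth
    have h₀ := (ih₀ hθ₀ hθη₀ (abs_update_zero_le hρ i)).trans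
      (mul_le_mul_of_nonneg_left (le_max_left _ _ : _ ≤ D) hρ0)
    have h₁ := (ih₁ hθ₁ hθη₁ (abs_update_zero_le hρ i)).trans
      (mul_le_mul_of_nonneg_left (le_max_right _ _ : _ ≤ D) hρ0)
    have hrange := abs_sub_le_of_nonneg_of_le (acceptProb_nonneg hθη₁ t₁)
      (acceptProb_le_one hθη₁ t₁) (acceptProb_nonneg hθη₀ t₀) (acceptProb_le_one hθη₀ t₀)
    have hmean := abs_one_sub_mul_add_mul_le ⟨hθ.1 i, hθ.2 i⟩ h₀ h₁
    have hshift := mul_le_mul (hρ i) hrange (abs_nonneg _) hρ0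
    rw [← abs_mul] at hshift
    calc _ = |_ + _| := by congr 1; ring
      _ ≤ ρ * D + ρ * 1 := (abs_add_le _ _).trans (add_le_add hmean hshift)
      _ = ρ * (query i t₀ t₁).depth := by
          rw [depth]
          push_cast
          ring

lemma abs_acceptProb_sub_acceptProb_add_sub_le {θ₀ θ₁ η : Fin n → ℝ} (hθ₀ : θ₀ ∈ Set.Icc 0 1)
    (hθ₁ : θ₁ ∈ Set.Icc 0 1) (hθη₀ : θ₀ + η ∈ Set.Icc 0 1) (hθη₁ : θ₁ + η ∈ Set.Icc 0 1) {ρ : ℝ}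
    (hρ0 : 0 ≤ ρ) (hρ : ∀ i, |η i| ≤ ρ) (t₀ t₁ : DecisionTree n) :
    |t₁.acceptProb (θ₁ + η) - t₀.acceptProb (θ₀ + η) - (t₁.acceptProb θ₁ - t₀.acceptProb θ₀)|
      ≤ 2 * (ρ * max (t₀.depth : ℝ) t₁.depth) := by
  rw [sub_sub_sub_comm, two_mul]
  exact (abs_sub _ _).trans (add_le_add
    ((abs_acceptProb_add_sub_le hθ₁ hθη₁ hρ t₁).trans
      (mul_le_mul_of_nonneg_left (le_max_right _ _) hρ0))
    ((abs_acceptProb_add_sub_le hθ₀ hθη₀ hρ t₀).trans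
      (mul_le_mul_of_nonneg_left (le_max_left _ _) hρ0)))

lemma abs_acceptProb_second_difference_le {θ η ζ : Fin n → ℝ} (hθ : θ ∈ Set.Icc 0 1)
    (hη : θ + η ∈ Set.Icc 0 1) (hζ : θ + ζ ∈ Set.Icc 0 1) (hηζ : θ + η + ζ ∈ Set.Icc 0 1) {ρ σ : ℝ}
    (hρ : ∀ i, |η i| ≤ ρ) (hσ : ∀ i, |ζ i| ≤ σ) (t : DecisionTree n) :
    |t.acceptProb (θ + η + ζ) - t.acceptProb (θ + η) - (t.acceptProb (θ + ζ) - t.acceptProb θ)|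
      ≤ 2 * ρ * σ * t.depth ^ 2 := by
  induction t generalizing θ η ζ with
  | leaf b => simp [acceptProb_leaf hθ, acceptProb_leaf hη, acceptProb_leaf hζ, acceptProb_leaf hηζ,
      depth]
  | query i t₀ t₁ ih₀ ih₁ =>
    have hρ0 : 0 ≤ ρ := (abs_nonneg _).trans (hρ i)
    have hσ0 : 0 ≤ σ := (abs_nonneg _).trans (hσ i)
    have hmem {ϑ : Fin n → ℝ} (hϑ : ϑ ∈ Set.Icc 0 1) := And.intro
      (update_mem_Icc_zero_one hϑ i unitInterval.zero_mem)
      (update_mem_Icc_zero_one hϑ i unitInterval.one_mem)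
    have hη' := hmem hη
    have hζ' := hmem hζ
    have hηζ' := hmem hηζ
    simp only [acceptProb_query, update_add_eq_add_update_zero, Pi.add_apply] at hη' hζ' hηζ' ⊢
    have hηi := abs_update_zero_le hρ i
    have hζi := abs_update_zero_le hσ i
    set D : ℝ := max t₀.depth t₁.depth
    have hsq : ((query i t₀ t₁).depth : ℝ) ^ 2 = (D + 1) ^ 2 := by rw [depth]; push_cast; rfl
    have hmean := abs_one_sub_mul_add_mul_le ⟨hθ.1 i, hθ.2 i⟩
      ((ih₀ (hmem hθ).1 hη'.1 hζ'.1 hηζ'.1 hηi hζi).trans (mul_le_mul_of_nonneg_left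
        (pow_le_pow_left₀ (Nat.cast_nonneg _) (le_max_left _ _ : _ ≤ D) 2) (by positivity)))
      ((ih₁ (hmem hθ).2 hη'.2 hζ'.2 hηζ'.2 hηi hζi).trans (mul_le_mul_of_nonneg_left
        (pow_le_pow_left₀ (Nat.cast_nonneg _) (le_max_right _ _ : _ ≤ D) 2) (by positivity)))
    have hgapζ := mul_le_mul (hρ i) (abs_acceptProb_sub_acceptProb_add_sub_le hη'.1 hη'.2 hηζ'.1
      hηζ'.2 hσ0 hζi t₀ t₁) (abs_nonneg _) hρ0
    simp only [add_right_comm _ (Function.update η i 0) (Function.update ζ i 0)] at hηζ'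
    have hgapη := mul_le_mul (hσ i) (abs_acceptProb_sub_acceptProb_add_sub_le hζ'.1 hζ'.2 hηζ'.1
      hηζ'.2 hρ0 hηi t₀ t₁) (abs_nonneg _) hσ0
    rw [← abs_mul] at hgapη hgapζ
    simp only [add_right_comm _ (Function.update ζ i 0) (Function.update η i 0)] at hgapη
    rw [hsq]
    calc _ = |_ + _ + _| := by congr 1; ring
      _ ≤ 2 * ρ * σ * D ^ 2 + ρ * (2 * (σ * D)) + σ * (2 * (ρ * D)) :=
        (abs_add_three _ _ _).trans (add_le_add_three hmean hgapζ hgapη)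
      _ ≤ 2 * ρ * σ * (D + 1) ^ 2 := by nlinarith [mul_nonneg hρ0 hσ0]

end Increments

section Truncation

variable {n : ℕ}

/-- The tree that is stopped after `L` queries, and then outputs `false`. -/
def truncate : ℕ → DecisionTree n → DecisionTree n
  | _, leaf b => leaf b
  | 0, query _ _ _ => leaf false
  | L + 1, query i t₀ t₁ => query i (truncate L t₀) (truncate L t₁)

/-- The tree that makes the same queries, but outputs `false` when it makes at most `L` of them. -/
def late : ℕ → DecisionTree n → DecisionTree n
  | _, leaf _ => leaf false
  | 0, query i t₀ t₁ => query i t₀ t₁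
  | L + 1, query i t₀ t₁ => query i (late L t₀) (late L t₁)

lemma depth_truncate_le (L : ℕ) (t : DecisionTree n) : (truncate L t).depth ≤ L := by
  induction t generalizing L with
  | leaf b => rw [truncate]; exact Nat.zero_le L
  | query i t₀ t₁ ih₀ ih₁ =>
    cases L with
    | zero => exact le_rfl
    | succ L => exact Nat.succ_le_succ (max_le (ih₀ L) (ih₁ L))

lemma cost_truncate (L : ℕ) (t : DecisionTree n) (x : Fin n → Bool) :
    (truncate L t).cost x = min (t.cost x) L := by
  induction t generalizing L with
  | leaf b => simp only [truncate, cost, Nat.zero_min]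
  | query i t₀ t₁ ih₀ ih₁ =>
    cases L with
    | zero => simp only [truncate, cost, Nat.min_zero]
    | succ L => simp only [truncate, cost, ih₀, ih₁]; split_ifs <;> omega

lemma eval_truncate (L : ℕ) (t : DecisionTree n) (x : Fin n → Bool) :
    (truncate L t).eval x = (t.eval x && decide (t.cost x ≤ L)) := by
  induction t generalizing L with
  | leaf b => simp [truncate, eval, cost]
  | query i t₀ t₁ ih₀ ih₁ =>
    cases L with
    | zero => simp [truncate, eval, cost]
    | succ L => simp only [truncate, eval, cost, ih₀, ih₁]; split_ifs <;> simp

lemma cost_late (L : ℕ) (t : DecisionTree n) (x : Fin n → Bool) : (late L t).cost x = t.cost x := by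
  induction t generalizing L with
  | leaf b => rw [late]; rfl
  | query i t₀ t₁ ih₀ ih₁ =>
    cases L with
    | zero => rfl
    | succ L => simp only [late, cost, ih₀, ih₁]

lemma eval_late (L : ℕ) (t : DecisionTree n) (x : Fin n → Bool) :
    (late L t).eval x = (t.eval x && decide (L < t.cost x)) := by
  induction t generalizing L with
  | leaf b => simp [late, eval, cost]
  | query i t₀ t₁ ih₀ ih₁ =>
    cases L with
    | zero => simp [late, eval, cost]
    | succ L => simp only [late, eval, cost, ih₀, ih₁]; split_ifs <;> simp

lemma meanCost_late (L : ℕ) (θ : Fin n → ℝ) (t : DecisionTree n) :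
    (late L t).meanCost θ = t.meanCost θ := by
  simp only [meanCost, cost_late]

lemma acceptProb_eq_truncate_add_late (L : ℕ) (θ : Fin n → ℝ) (t : DecisionTree n) :
    t.acceptProb θ = (truncate L t).acceptProb θ + (late L t).acceptProb θ := by
  rw [acceptProb, acceptProb, acceptProb, ← map_add]
  congr 1
  ext x
  simp only [Pi.add_apply, accept, eval_truncate, eval_late]
  rcases le_or_gt (t.cost x) L with h | h
  · simp [h, h.not_gt]
  · simp [h, h.not_ge]

lemma mul_acceptProb_late_le {θ : Fin n → ℝ} (hθ : θ ∈ Set.Icc 0 1) (L : ℕ) (t : DecisionTree n) :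
    L * (late L t).acceptProb θ ≤ t.meanCost θ := by
  rw [acceptProb, ← smul_eq_mul, ← map_smul]
  refine weightedMean_mono (bitWeight_mem_stdSimplex hθ) fun x _ => ?_
  rw [Pi.smul_apply, smul_eq_mul, accept, eval_late]
  rcases le_or_gt (t.cost x) L with h | h
  · simp [h.not_gt]
  · calc (L : ℝ) * _ ≤ L * 1 := by gcongr; exact_mod_cast Bool.toNat_le _
      _ ≤ t.cost x := by rw [mul_one]; exact_mod_cast h.le

lemma abs_acceptProb_late_sub_le {θ θ' : Fin n → ℝ} (hθ : θ ∈ Set.Icc 0 1) (hθ' : θ' ∈ Set.Icc 0 1)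
    {p : ℝ} (hp : 0 < p) (h : ∀ i, (θ' i - θ i) ^ 2 ≤ p ^ 2 * (θ i * (1 - θ i))) {m : ℕ}
    (hm : 0 < m) (hpm : p * m ≤ 1) (t : DecisionTree n) :
    |(late (m ^ 2) t).acceptProb θ' - (late (m ^ 2) t).acceptProb θ|
      ≤ p / m * (t.meanCost θ + t.meanCost θ') := by
  have hmarkov := mul_acceptProb_late_le hθ (m ^ 2) t
  push_cast at hmarkov
  calc _ ≤ p * m * (late (m ^ 2) t).acceptProb θ + p ^ 2 / (p * m) * (late (m ^ 2) t).meanCost θ' :=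
        abs_acceptProb_sub_le hθ hθ' h (by positivity) hpm _
    _ = p / m * (m ^ 2 * (late (m ^ 2) t).acceptProb θ + t.meanCost θ') := by
        rw [meanCost_late]
        field_simp
    _ ≤ p / m * (t.meanCost θ + t.meanCost θ') := by gcongr

lemma add_natCast_smul_mem_of_convex {E : Type*} [AddCommGroup E] [Module ℝ E] {K : Set E}
    (hK : Convex ℝ K) {x y : E} {j k : ℕ} (hx : x ∈ K) (hxy : x + (k : ℝ) • y ∈ K) (hjk : j ≤ k) :
    x + (j : ℝ) • y ∈ K := by
  obtain rfl | hk := k.eq_zero_or_pos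
  · simpa [Nat.le_zero.1 hjk] using hx
  have hk0 : (0 : ℝ) < k := by exact_mod_cast hk
  have hmem := hK.add_smul_mem hx hxy (t := (j / k : ℝ))
    ⟨by positivity, div_le_one_of_le₀ (by exact_mod_cast hjk) hk0.le⟩
  rwa [smul_smul, div_mul_cancel₀ _ hk0.ne'] at hmem

lemma abs_truncate_increment_sub_le {θ θ' η : Fin n → ℝ} (k : ℕ) (hθ : θ ∈ Set.Icc 0 1)
    (hθη : θ + η ∈ Set.Icc 0 1) (hθ' : θ' ∈ Set.Icc 0 1) (hθ'η : θ' + (k : ℝ) • η ∈ Set.Icc 0 1)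
    {ρ r : ℝ} (hρ0 : 0 ≤ ρ) (hr0 : 0 ≤ r) (hρ : ∀ i, |η i| ≤ ρ) (hr : ∀ i, |θ' i - θ i| ≤ r)
    (L : ℕ) (t : DecisionTree n) :
    |(truncate L t).acceptProb (θ' + (k : ℝ) • η) - (truncate L t).acceptProb θ'
        - k * ((truncate L t).acceptProb (θ + η) - (truncate L t).acceptProb θ)|
      ≤ k * (2 * ρ * (r + k * ρ) * L ^ 2) := by
  set A : (Fin n → ℝ) → ℝ := fun ϑ => (truncate L t).acceptProb ϑ
  have hmem (j : ℕ) (hj : j ≤ k) : θ' + (j : ℝ) • η ∈ Set.Icc 0 1 :=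
    add_natCast_smul_mem_of_convex (convex_Icc 0 1) hθ' hθ'η hj
  have hstep (j : ℕ) (hj : j < k) :
      |A (θ' + ((j + 1 : ℕ) : ℝ) • η) - A (θ' + (j : ℝ) • η) - (A (θ + η) - A θ)|
        ≤ 2 * ρ * (r + k * ρ) * L ^ 2 := by
    have hζ : θ + (θ' - θ + (j : ℝ) • η) = θ' + (j : ℝ) • η := by abel
    have hηζ : θ + (θ' - θ + (j : ℝ) • η) + η = θ' + ((j + 1 : ℕ) : ℝ) • η := by
      push_cast
      module
    have hσ (i : Fin n) : |(θ' - θ + (j : ℝ) • η) i| ≤ r + k * ρ := by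
      have hjk : (j : ℝ) ≤ k := by exact_mod_cast hj.le
      refine (abs_add_le _ _).trans (add_le_add (hr i) ?_)
      rw [Pi.smul_apply, smul_eq_mul, abs_mul, Nat.abs_cast]
      exact mul_le_mul hjk (hρ i) (abs_nonneg _) (Nat.cast_nonneg k)
    have hdiff := abs_acceptProb_second_difference_le hθ (hζ ▸ hmem j hj.le) hθη
      (hηζ ▸ hmem (j + 1) hj) hσ hρ (truncate L t)
    rw [hηζ, hζ] at hdiff
    have hdepth : ((truncate L t).depth : ℝ) ≤ L := by exact_mod_cast depth_truncate_le L t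
    calc _ ≤ 2 * (r + k * ρ) * ρ * ((truncate L t).depth : ℝ) ^ 2 := hdiff
      _ ≤ 2 * (r + k * ρ) * ρ * L ^ 2 := by gcongr
      _ = 2 * ρ * (r + k * ρ) * L ^ 2 := by ring
  have htele : A (θ' + (k : ℝ) • η) - A θ' - k * (A (θ + η) - A θ)
      = ∑ j ∈ Finset.range k,
        (A (θ' + ((j + 1 : ℕ) : ℝ) • η) - A (θ' + (j : ℝ) • η) - (A (θ + η) - A θ)) := by
    rw [Finset.sum_sub_distrib, Finset.sum_range_sub fun j : ℕ => A (θ' + (j : ℝ) • η)]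
    simp only [Finset.sum_const, Finset.card_range, nsmul_eq_mul, Nat.cast_zero, zero_smul,
      add_zero]
  calc _ = |∑ j ∈ Finset.range k,
        (A (θ' + ((j + 1 : ℕ) : ℝ) • η) - A (θ' + (j : ℝ) • η) - (A (θ + η) - A θ))| := by
        rw [← htele]
    _ ≤ ∑ _j ∈ Finset.range k, 2 * ρ * (r + k * ρ) * L ^ 2 :=
        (Finset.abs_sum_le_sum_abs _ _).trans
          (Finset.sum_le_sum fun j hj => hstep j (Finset.mem_range.1 hj))
    _ = _ := by simp

lemma mul_acceptProb_increment_le {θ θ' η : Fin n → ℝ} {k m : ℕ} (hk : 0 < k) (hm : 0 < m)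
    (hθ : θ ∈ Set.Icc 0 1) (hθη : θ + η ∈ Set.Icc 0 1) (hθ' : θ' ∈ Set.Icc 0 1)
    (hθ'η : θ' + (k : ℝ) • η ∈ Set.Icc 0 1)
    {ρ r p : ℝ} (hρ0 : 0 ≤ ρ) (hr0 : 0 ≤ r) (hρ : ∀ i, |η i| ≤ ρ) (hr : ∀ i, |θ' i - θ i| ≤ r)
    (hp : 0 < p) (hpk : k * p * m ≤ 1) (hθp : ∀ i, η i ^ 2 ≤ p ^ 2 * (θ i * (1 - θ i)))
    (hθ'p : ∀ i, η i ^ 2 ≤ p ^ 2 * (θ' i * (1 - θ' i))) (t : DecisionTree n) :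
    k * (t.acceptProb (θ + η) - t.acceptProb θ)
      ≤ t.acceptProb (θ' + (k : ℝ) • η) - t.acceptProb θ' + k * (2 * ρ * (r + k * ρ) * m ^ 4)
        + k * p / m * (t.meanCost θ + t.meanCost (θ + η)
          + (t.meanCost θ' + t.meanCost (θ' + (k : ℝ) • η))) := by
  have hm0 : (0 : ℝ) < m := by exact_mod_cast hm
  have hk1 : (1 : ℝ) ≤ k := by exact_mod_cast hk
  have htrunc := abs_truncate_increment_sub_le k hθ hθη hθ' hθ'η hρ0 hr0 hρ hr (m ^ 2) t
  have hlate : k * |(late (m ^ 2) t).acceptProb (θ + η) - (late (m ^ 2) t).acceptProb θ|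
      ≤ k * (p / m * (t.meanCost θ + t.meanCost (θ + η))) := by
    gcongr
    refine abs_acceptProb_late_sub_le hθ hθη hp (fun i => ?_) hm (hpk.trans' ?_) t
    · simpa using hθp i
    · exact mul_le_mul_of_nonneg_right (le_mul_of_one_le_left hp.le hk1) hm0.le
  have hlate' := abs_acceptProb_late_sub_le hθ' hθ'η (p := k * p) (by positivity)
    (fun i => by
      simpa [mul_pow, mul_assoc] using mul_le_mul_of_nonneg_left (hθ'p i) (sq_nonneg (k : ℝ)))
    hm hpk t
  rw [acceptProb_eq_truncate_add_late (m ^ 2) (θ + η), acceptProb_eq_truncate_add_late (m ^ 2) θ,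
    acceptProb_eq_truncate_add_late (m ^ 2) θ',
    acceptProb_eq_truncate_add_late (m ^ 2) (θ' + (k : ℝ) • η)]
  push_cast at htrunc
  have h1 := (abs_le.1 htrunc).1
  have h2 := (abs_le.1 hlate').1
  have h3 := (mul_le_mul_of_nonneg_left (le_abs_self _) (zero_le_one.trans hk1)).trans hlate
  linear_combination h1 + h2 + h3

end Truncation

end DecisionTree

section DiscreteExpectation

lemma tsum_pure_mul {α : Type*} (a : α) (F : α → ℝ≥0∞) : ∑' b, PMF.pure a b * F b = F a := by
  rw [tsum_eq_single a fun b hb => by rw [PMF.pure_apply_of_ne _ _ hb, zero_mul],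
    PMF.pure_apply_self, one_mul]

lemma tsum_bind_mul {α β : Type*} (p : PMF α) (q : α → PMF β) (F : β → ℝ≥0∞) :
    ∑' b, p.bind q b * F b = ∑' a, p a * ∑' b, q a b * F b := by
  simp only [PMF.bind_apply, ← ENNReal.tsum_mul_right, ← ENNReal.tsum_mul_left, mul_assoc]
  exact ENNReal.tsum_comm

lemma tsum_map_mul {α β : Type*} (p : PMF α) (g : α → β) (F : β → ℝ≥0∞) :
    ∑' b, p.map g b * F b = ∑' a, p a * F (g a) := by
  simp only [PMF.map, tsum_bind_mul, Function.comp_apply, tsum_pure_mul]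

lemma hasSum_toReal_mul_toReal {α : Type*} (p : PMF α) {F : α → ℝ≥0∞} (h : ∑' a, p a * F a ≠ ∞) :
    HasSum (fun a => (p a).toReal * (F a).toReal) (∑' a, p a * F a).toReal := by
  rw [ENNReal.tsum_toReal_eq (ENNReal.ne_top_of_tsum_ne_top h)]
  simpa only [ENNReal.toReal_mul] using ENNReal.hasSum_toReal h

lemma toReal_mem_stdSimplex {α : Type*} [Fintype α] (p : PMF α) :
    (fun a => (p a).toReal) ∈ stdSimplex ℝ α := by
  refine ⟨fun a => ENNReal.toReal_nonneg, ?_⟩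
  rw [← ENNReal.toReal_sum fun a _ => p.apply_ne_top a, ← tsum_fintype (L := .unconditional α),
    p.tsum_coe, ENNReal.toReal_one]

end DiscreteExpectation

namespace RandomizedAlgorithm

variable {n : ℕ}

section Averaging

lemma outputProb_true_add_outputProb_false (R : RandomizedAlgorithm n) (x : Fin n → Bool) :
    R.outputProb x true + R.outputProb x false = 1 := by
  rw [outputProb, outputProb, ← ENNReal.tsum_add, ← R.tsum_coe]
  refine tsum_congr fun D => ?_
  cases D.eval x <;> simp

lemma outputProb_le_one (R : RandomizedAlgorithm n) (x : Fin n → Bool) (b : Bool) :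
    R.outputProb x b ≤ 1 := by
  rw [← R.outputProb_true_add_outputProb_false x]
  cases b
  exacts [le_add_self, le_self_add]

lemma outputProb_ne_top (R : RandomizedAlgorithm n) (x : Fin n → Bool) (b : Bool) :
    R.outputProb x b ≠ ∞ :=
  ne_top_of_le_ne_top ENNReal.one_ne_top (R.outputProb_le_one x b)

/-- The probability that `R` outputs `true`, as a real function of the input. -/
noncomputable def accept (R : RandomizedAlgorithm n) (x : Fin n → Bool) : ℝ :=
  (R.outputProb x true).toReal

/-- The expected number of queries of `R`, as a real function of the input; it is `0` where that
expectation is infinite. -/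
noncomputable def queries (R : RandomizedAlgorithm n) (x : Fin n → Bool) : ℝ :=
  (R.expectedCost x).toReal

lemma toReal_outputProb_false (R : RandomizedAlgorithm n) (x : Fin n → Bool) :
    (R.outputProb x false).toReal = 1 - R.accept x := by
  rw [accept, eq_sub_iff_add_eq', ← ENNReal.toReal_add (R.outputProb_ne_top x _)
    (R.outputProb_ne_top x _), outputProb_true_add_outputProb_false, ENNReal.toReal_one]

lemma accept_nonneg (R : RandomizedAlgorithm n) (x : Fin n → Bool) : 0 ≤ R.accept x :=
  ENNReal.toReal_nonneg

lemma accept_le_one (R : RandomizedAlgorithm n) (x : Fin n → Bool) : R.accept x ≤ 1 :=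
  ENNReal.toReal_le_of_le_ofReal zero_le_one (by simpa using R.outputProb_le_one x true)

lemma hasSum_smul_accept (R : RandomizedAlgorithm n) :
    HasSum (fun D => (R D).toReal • D.accept) R.accept := by
  refine Pi.hasSum.2 fun x => ?_
  convert hasSum_toReal_mul_toReal R (R.outputProb_ne_top x true) using 2 with D
  · rw [Pi.smul_apply, smul_eq_mul, DecisionTree.accept]
    cases D.eval x <;> simp
  · rfl

lemma hasSum_smul_cost (R : RandomizedAlgorithm n) (hR : ∀ x, R.expectedCost x ≠ ∞) :
    HasSum (fun D => (R D).toReal • fun x => (D.cost x : ℝ)) R.queries := by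
  refine Pi.hasSum.2 fun x => ?_
  convert hasSum_toReal_mul_toReal R (hR x) using 2 with D
  · rw [Pi.smul_apply, smul_eq_mul, ENNReal.toReal_natCast]
  · rfl

lemma linearMap_accept_le (R : RandomizedAlgorithm n) (hR : ∀ x, R.expectedCost x ≠ ∞)
    (Λ Γ : ((Fin n → Bool) → ℝ) →ₗ[ℝ] ℝ) {κ : ℝ}
    (h : ∀ D : DecisionTree n, Λ D.accept ≤ Γ (fun x => (D.cost x : ℝ)) + κ) :
    Λ R.accept ≤ Γ R.queries + κ := by
  have hsum : HasSum (fun D => (R D).toReal) 1 := by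
    simpa [R.tsum_coe] using hasSum_toReal_mul_toReal R (F := 1) (by simp [R.tsum_coe])
  have hΛ := R.hasSum_smul_accept.mapL Λ.toContinuousLinearMap
  have hΓ := (R.hasSum_smul_cost hR).mapL Γ.toContinuousLinearMap
  rw [← one_mul κ]
  refine hasSum_le (fun D => ?_) hΛ (hΓ.add (hsum.mul_right κ))
  simp only [LinearMap.coe_toContinuousLinearMap', map_smul, smul_eq_mul]
  rw [← mul_add]
  exact mul_le_mul_of_nonneg_left (h D) ENNReal.toReal_nonneg

lemma sum_bitMean_update_one_accept_sub_le (R : RandomizedAlgorithm n)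
    (hR : ∀ x, R.expectedCost x ≠ ∞) {θ : Fin n → ℝ} (hθ : θ ∈ Set.Icc 0 1) (J : Finset (Fin n)) :
    ∑ j ∈ J, (bitMean (Function.update θ j 1) R.accept - bitMean θ R.accept)
      ≤ bitMean θ R.queries := by
  have h := R.linearMap_accept_le hR (∑ j ∈ J, (bitMean (Function.update θ j 1) - bitMean θ))
    (bitMean θ) (κ := 0) fun D => by
      simp only [LinearMap.sum_apply, LinearMap.sub_apply, add_zero]
      exact (Finset.sum_le_sum fun j _ => le_abs_self _).trans
        (D.sum_abs_acceptProb_update_one_sub_le hθ J)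
  simpa only [LinearMap.sum_apply, LinearMap.sub_apply, add_zero] using h

lemma mul_bitMean_accept_increment_le (R : RandomizedAlgorithm n) (hR : ∀ x, R.expectedCost x ≠ ∞)
    {θ θ' η : Fin n → ℝ} {k m : ℕ} (hk : 0 < k) (hm : 0 < m)
    (hθ : θ ∈ Set.Icc 0 1) (hθη : θ + η ∈ Set.Icc 0 1) (hθ' : θ' ∈ Set.Icc 0 1)
    (hθ'η : θ' + (k : ℝ) • η ∈ Set.Icc 0 1)
    {ρ r p : ℝ} (hρ0 : 0 ≤ ρ) (hr0 : 0 ≤ r) (hρ : ∀ i, |η i| ≤ ρ) (hr : ∀ i, |θ' i - θ i| ≤ r)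
    (hp : 0 < p) (hpk : k * p * m ≤ 1) (hθp : ∀ i, η i ^ 2 ≤ p ^ 2 * (θ i * (1 - θ i)))
    (hθ'p : ∀ i, η i ^ 2 ≤ p ^ 2 * (θ' i * (1 - θ' i))) :
    k * (bitMean (θ + η) R.accept - bitMean θ R.accept)
      ≤ bitMean (θ' + (k : ℝ) • η) R.accept - bitMean θ' R.accept
        + k * (2 * ρ * (r + k * ρ) * m ^ 4)
        + k * p / m * (bitMean θ R.queries + bitMean (θ + η) R.queries
          + (bitMean θ' R.queries + bitMean (θ' + (k : ℝ) • η) R.queries)) := by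
  have h := R.linearMap_accept_le hR
    ((k : ℝ) • (bitMean (θ + η) - bitMean θ) - (bitMean (θ' + (k : ℝ) • η) - bitMean θ'))
    ((k * p / m : ℝ) • (bitMean θ + bitMean (θ + η) + (bitMean θ' + bitMean (θ' + (k : ℝ) • η))))
    (κ := k * (2 * ρ * (r + k * ρ) * m ^ 4)) fun D => by
      have := D.mul_acceptProb_increment_le hk hm hθ hθη hθ' hθ'η hρ0 hr0 hρ hr hp hpk hθp hθ'p
      simp only [LinearMap.sub_apply, LinearMap.smul_apply, LinearMap.add_apply, smul_eq_mul]
      simp only [DecisionTree.acceptProb, DecisionTree.meanCost] at this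
      linarith
  simp only [LinearMap.sub_apply, LinearMap.smul_apply, LinearMap.add_apply, smul_eq_mul] at h
  linarith

end Averaging

section Truncation

variable (R : RandomizedAlgorithm n) (M : ℕ) (x : Fin n → Bool)

/-- The algorithm that is stopped after `M` queries, and then outputs `false`. -/
noncomputable def truncate : RandomizedAlgorithm n :=
  R.map (DecisionTree.truncate M)

lemma expectedCost_truncate_le : (R.truncate M).expectedCost x ≤ R.expectedCost x := by
  rw [expectedCost, truncate, tsum_map_mul]
  refine ENNReal.tsum_le_tsum fun D => ?_
  rw [DecisionTree.cost_truncate]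
  gcongr
  exact min_le_left _ _

lemma expectedCost_truncate_le_natCast : (R.truncate M).expectedCost x ≤ M := by
  rw [expectedCost, truncate, tsum_map_mul]
  calc _ ≤ ∑' D, R D * (M : ℝ≥0∞) := ENNReal.tsum_le_tsum fun D => by
        rw [DecisionTree.cost_truncate]
        gcongr
        exact min_le_right _ _
    _ = M := by rw [ENNReal.tsum_mul_right, R.tsum_coe, one_mul]

lemma expectedCost_truncate_ne_top : (R.truncate M).expectedCost x ≠ ∞ :=
  ne_top_of_le_ne_top (ENNReal.natCast_ne_top M) (R.expectedCost_truncate_le_natCast M x)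

lemma queries_truncate_le : (R.truncate M).queries x ≤ M :=
  ENNReal.toReal_le_of_le_ofReal M.cast_nonneg
    (by simpa using R.expectedCost_truncate_le_natCast M x)

lemma accept_truncate_le : (R.truncate M).accept x ≤ R.accept x := by
  refine ENNReal.toReal_mono (R.outputProb_ne_top x true) ?_
  rw [outputProb, truncate, tsum_map_mul]
  refine ENNReal.tsum_le_tsum fun D => ?_
  rw [DecisionTree.eval_truncate]
  gcongr
  cases D.eval x
  · simp
  · simp only [Bool.true_and, decide_eq_true_eq, if_true]
    split_ifs <;> simp

lemma natCast_mul_outputProb_le :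
    M * R.outputProb x true ≤ M * (R.truncate M).outputProb x true + R.expectedCost x := by
  rw [outputProb, outputProb, truncate, tsum_map_mul, expectedCost, ← ENNReal.tsum_mul_left,
    ← ENNReal.tsum_mul_left, ← ENNReal.tsum_add]
  refine ENNReal.tsum_le_tsum fun D => ?_
  rw [DecisionTree.eval_truncate]
  rcases le_or_gt (D.cost x) M with h | h
  · simp [h]
  · have hM : (M : ℝ≥0∞) ≤ D.cost x := by exact_mod_cast h.le
    cases D.eval x
    · simp
    · simpa [h.not_ge, mul_comm] using mul_le_mul_right hM (R D)

lemma accept_sub_div_le_accept_truncate (hM : 0 < M) (hx : R.expectedCost x ≠ ∞) :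
    R.accept x - R.queries x / M ≤ (R.truncate M).accept x := by
  have hM0 : (0 : ℝ) < M := by exact_mod_cast hM
  have hfinite : M * (R.truncate M).outputProb x true + R.expectedCost x ≠ ∞ :=
    ENNReal.add_ne_top.2 ⟨ENNReal.mul_ne_top (ENNReal.natCast_ne_top M)
      ((R.truncate M).outputProb_ne_top x true), hx⟩
  have h := ENNReal.toReal_mono hfinite (R.natCast_mul_outputProb_le M x)
  rw [ENNReal.toReal_add (ENNReal.add_ne_top.1 hfinite).1 hx, ENNReal.toReal_mul,
    ENNReal.toReal_mul, ENNReal.toReal_natCast] at h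
  rw [sub_le_iff_le_add, ← sub_le_iff_le_add', le_div_iff₀ hM0, accept, accept, queries]
  linarith

end Truncation

end RandomizedAlgorithm

section LowerBound

namespace RandomizedAlgorithm

variable {n : ℕ} {X : Set (Fin n → Bool)} {f : X → Bool} {R : RandomizedAlgorithm n}
  {θ : Fin n → ℝ} {γ ε T : ℝ} {M : ℕ}

lemma ofReal_le_outputProb (hR : ENNReal.ofReal γ ≤ R.worstSuccess f) (x : X) :
    ENNReal.ofReal γ ≤ R.outputProb x (f x) :=
  hR.trans (iInf_le _ x)

lemma le_toReal_outputProb (hR : ENNReal.ofReal γ ≤ R.worstSuccess f) (x : X) :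
    γ ≤ (R.outputProb x (f x)).toReal :=
  (ENNReal.ofReal_le_iff_le_toReal (R.outputProb_ne_top _ _)).1 (ofReal_le_outputProb hR x)

lemma expectedCost_le_ofReal (hT : R.worstExpectedCost X ≤ ENNReal.ofReal T) (x : X) :
    R.expectedCost x ≤ ENNReal.ofReal T :=
  (le_iSup (fun x : X => R.expectedCost x) x).trans hT

lemma queries_truncate_le_of_worstExpectedCost_le (hT0 : 0 ≤ T)
    (hT : R.worstExpectedCost X ≤ ENNReal.ofReal T) (M : ℕ) (x : X) :
    (R.truncate M).queries x ≤ T :=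
  ENNReal.toReal_le_of_le_ofReal hT0
    ((R.expectedCost_truncate_le M x).trans (expectedCost_le_ofReal hT x))

lemma accept_truncate_le_of_eq_false (hR : ENNReal.ofReal γ ≤ R.worstSuccess f) (M : ℕ) {x : X}
    (hx : f x = false) : (R.truncate M).accept x ≤ 1 - γ := by
  have h := le_toReal_outputProb hR x
  rw [hx, toReal_outputProb_false] at h
  linarith [R.accept_truncate_le M x]

lemma sub_div_le_accept_truncate_of_eq_true (hR : ENNReal.ofReal γ ≤ R.worstSuccess f) (hT0 : 0 ≤ T)
    (hT : R.worstExpectedCost X ≤ ENNReal.ofReal T) (hM : 0 < M) {x : X} (hx : f x = true) :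
    γ - T / M ≤ (R.truncate M).accept x := by
  have h := le_toReal_outputProb hR x
  rw [hx] at h
  have hcost := expectedCost_le_ofReal hT x
  refine (sub_le_sub h ?_).trans (R.accept_sub_div_le_accept_truncate M x hM
    (ne_top_of_le_ne_top ENNReal.ofReal_ne_top hcost))
  gcongr
  exact ENNReal.toReal_le_of_le_ofReal hT0 hcost

lemma bitMean_queries_truncate_le (hθ : θ ∈ Set.Icc 0 1) (hθX : bitMean θ (Xᶜ.indicator 1) ≤ ε)
    (hT0 : 0 ≤ T) (hT : R.worstExpectedCost X ≤ ENNReal.ofReal T) :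
    bitMean θ (R.truncate M).queries ≤ T + M * ε := by
  refine (weightedMean_le_add (E := Xᶜ) (bitWeight_mem_stdSimplex hθ) (u := T) (C := M) ?_ ?_).trans
    (add_le_add_right (mul_le_mul_of_nonneg_left hθX M.cast_nonneg) T)
  · intro x hx _
    exact queries_truncate_le_of_worstExpectedCost_le hT0 hT M ⟨x, not_not.1 hx⟩
  · intro x
    linarith [R.queries_truncate_le M x]

lemma bitMean_accept_truncate_le (hθ : θ ∈ Set.Icc 0 1)
    (hθf : bitMean θ ((Subtype.val '' (f ⁻¹' {false}))ᶜ.indicator 1) ≤ ε) (hγ : γ ≤ 1)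
    (hR : ENNReal.ofReal γ ≤ R.worstSuccess f) :
    bitMean θ (R.truncate M).accept ≤ 1 - γ + ε := by
  have h := weightedMean_le_add (F := (R.truncate M).accept)
    (E := (Subtype.val '' (f ⁻¹' {false}))ᶜ) (bitWeight_mem_stdSimplex hθ)
    (u := 1 - γ) (C := 1) ?_ ?_
  · linarith!
  · intro x hx _
    obtain ⟨y, hy, rfl⟩ := not_not.1 hx
    exact accept_truncate_le_of_eq_false hR M hy
  · intro x
    linarith [(R.truncate M).accept_le_one x]

lemma le_bitMean_accept_truncate (hθ : θ ∈ Set.Icc 0 1)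
    (hθf : bitMean θ ((Subtype.val '' (f ⁻¹' {true}))ᶜ.indicator 1) ≤ ε) (hγ : γ ≤ 1)
    (hR : ENNReal.ofReal γ ≤ R.worstSuccess f) (hT0 : 0 ≤ T)
    (hT : R.worstExpectedCost X ≤ ENNReal.ofReal T) (hM : 0 < M) :
    γ - T / M - ε ≤ bitMean θ (R.truncate M).accept := by
  have h := sub_le_weightedMean (F := (R.truncate M).accept) (E := (Subtype.val '' (f ⁻¹' {true}))ᶜ)
    (bitWeight_mem_stdSimplex hθ) (l := γ - T / M) (C := 1) ?_ ?_
  · linarith!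
  · intro x hx _
    obtain ⟨y, hy, rfl⟩ := not_not.1 hx
    exact sub_div_le_accept_truncate_of_eq_true hR hT0 hT hM hy
  · intro x
    have : 0 ≤ T / M := by positivity
    linarith [(R.truncate M).accept_nonneg x]

end RandomizedAlgorithm

open RandomizedAlgorithm

variable {n : ℕ} {X : Set (Fin n → Bool)}

lemma bitMean_compl_domain_le {f : X → Bool} {θ : Fin n → ℝ} (hθ : θ ∈ Set.Icc 0 1) {ε : ℝ}
    {b : Bool} (h : bitMean θ ((Subtype.val '' (f ⁻¹' {b}))ᶜ.indicator 1) ≤ ε) :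
    bitMean θ (Xᶜ.indicator 1) ≤ ε := by
  refine (weightedMean_mono (bitWeight_mem_stdSimplex hθ) fun x _ => ?_).trans h
  exact Set.indicator_le_indicator_of_subset
    (Set.compl_subset_compl.2 (Subtype.coe_image_subset X _)) (fun _ => zero_le_one) x

lemma card_mul_le_of_bitMean_update_one {R : RandomizedAlgorithm n}
    (hR : ∀ x, R.expectedCost x ≠ ∞) {θ : Fin n → ℝ} (hθ : θ ∈ Set.Icc 0 1) {J : Finset (Fin n)}
    {a : ℝ} (h : ∀ j ∈ J, a ≤ bitMean (Function.update θ j 1) R.accept) :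
    J.card * (a - bitMean θ R.accept) ≤ bitMean θ R.queries := by
  rw [← nsmul_eq_mul, ← Finset.sum_const]
  exact (Finset.sum_le_sum fun j hj => sub_le_sub_right (h j hj) _).trans
    (R.sum_bitMean_update_one_accept_sub_le hR hθ J)

lemma mul_half_le_of_worstSuccess {f : X → Bool} {R : RandomizedAlgorithm n} {θ θ' η : Fin n → ℝ}
    {J : Finset (Fin n)} {d ε T ρ r p : ℝ} {k m M : ℕ} (hk : 0 < k) (hm : 0 < m) (hM : 0 < M)
    (hT0 : 0 ≤ T) (hd1 : d ≤ 1) (hJ : J.Nonempty) (hε : ε ≤ d / 10) (hMε : M * ε ≤ T)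
    (hTM : T / M ≤ d / 10) (hθ : θ ∈ Set.Icc 0 1) (hθη : θ + η ∈ Set.Icc 0 1)
    (hθ' : θ' ∈ Set.Icc 0 1) (hθ'η : θ' + (k : ℝ) • η ∈ Set.Icc 0 1)
    (hρ0 : 0 ≤ ρ) (hr0 : 0 ≤ r) (hρ : ∀ i, |η i| ≤ ρ) (hr : ∀ i, |θ' i - θ i| ≤ r)
    (hp : 0 < p) (hpk : k * p * m ≤ 1) (hθp : ∀ i, η i ^ 2 ≤ p ^ 2 * (θ i * (1 - θ i)))
    (hθ'p : ∀ i, η i ^ 2 ≤ p ^ 2 * (θ' i * (1 - θ' i)))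
    (hfθ : bitMean θ ((Subtype.val '' (f ⁻¹' {false}))ᶜ.indicator 1) ≤ ε)
    (hfθη : bitMean (θ + η) ((Subtype.val '' (f ⁻¹' {true}))ᶜ.indicator 1) ≤ ε)
    (hfθ' : bitMean θ' ((Subtype.val '' (f ⁻¹' {false}))ᶜ.indicator 1) ≤ ε)
    (hfθ'η : bitMean (θ' + (k : ℝ) • η) ((Subtype.val '' (f ⁻¹' {false}))ᶜ.indicator 1) ≤ ε)
    (hfJ : ∀ j ∈ J, bitMean (Function.update θ' j 1)
      ((Subtype.val '' (f ⁻¹' {true}))ᶜ.indicator 1) ≤ ε)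
    (hR : ENNReal.ofReal ((1 + d) / 2) ≤ R.worstSuccess f)
    (hT : R.worstExpectedCost X ≤ ENNReal.ofReal T) :
    k * d / 2 ≤ 2 * T / J.card + k * (2 * ρ * (r + k * ρ) * m ^ 4) + k * p / m * (8 * T) := by
  set R' := R.truncate M
  have hfinite (x : Fin n → Bool) : R'.expectedCost x ≠ ∞ := R.expectedCost_truncate_ne_top M x
  have hγ : (1 + d) / 2 ≤ 1 := by linarith
  have hd0 : 0 ≤ d := by linarith [show 0 ≤ T / M by positivity]
  have hreject {ϑ : Fin n → ℝ} (hϑ : ϑ ∈ Set.Icc 0 1)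
      (hfϑ : bitMean ϑ ((Subtype.val '' (f ⁻¹' {false}))ᶜ.indicator 1) ≤ ε) :
      bitMean ϑ R'.accept ≤ (1 - d) / 2 + d / 10 := by
    linarith [bitMean_accept_truncate_le (M := M) hϑ hfϑ hγ hR]
  have haccept {ϑ : Fin n → ℝ} (hϑ : ϑ ∈ Set.Icc 0 1)
      (hfϑ : bitMean ϑ ((Subtype.val '' (f ⁻¹' {true}))ᶜ.indicator 1) ≤ ε) :
      (1 + d) / 2 - d / 10 - d / 10 ≤ bitMean ϑ R'.accept := by
    linarith [le_bitMean_accept_truncate (M := M) hϑ hfϑ hγ hR hT0 hT hM]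
  have hqueries {ϑ : Fin n → ℝ} (hϑ : ϑ ∈ Set.Icc 0 1) {b : Bool}
      (hfϑ : bitMean ϑ ((Subtype.val '' (f ⁻¹' {b}))ᶜ.indicator 1) ≤ ε) :
      bitMean ϑ R'.queries ≤ 2 * T := by
    linarith [bitMean_queries_truncate_le (M := M) hϑ (bitMean_compl_domain_le hϑ hfϑ) hT0 hT]
  have hgap : d / 2 ≤ bitMean (θ + η) R'.accept - bitMean θ R'.accept := by
    linarith [haccept hθη hfθη, hreject hθ hfθ]
  have hmarks : bitMean (θ' + (k : ℝ) • η) R'.accept - bitMean θ' R'.accept ≤ 2 * T / J.card := by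
    rw [le_div_iff₀' (by exact_mod_cast hJ.card_pos)]
    refine (card_mul_le_of_bitMean_update_one hfinite hθ' fun j hj => ?_).trans (hqueries hθ' hfθ')
    linarith [haccept (update_mem_Icc_zero_one hθ' j unitInterval.one_mem) (hfJ j hj),
      hreject hθ'η hfθ'η]
  have htransfer := R'.mul_bitMean_accept_increment_le hfinite hk hm hθ hθη hθ' hθ'η hρ0 hr0 hρ hr
    hp hpk hθp hθ'p
  calc k * d / 2 = k * (d / 2) := mul_div_assoc _ _ _
    _ ≤ k * (bitMean (θ + η) R'.accept - bitMean θ R'.accept) := by gcongr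
    _ ≤ _ := htransfer
    _ ≤ _ := by
      gcongr
      linarith [hqueries hθ hfθ, hqueries hθη hfθη, hqueries hθ' hfθ', hqueries hθ'η hfθ'η]

end LowerBound

/-- A choice of three disjoint blocks of input bits: the sign bits, of which an algorithm wants to
know whether most of them are `true`, the flag bits, which announce that the answer is to be read
off the mark bits, and the mark bits. -/
structure InputBlocks (n : ℕ) where
  signs : Finset (Fin n)
  flags : Finset (Fin n)
  marks : Finset (Fin n)
  disjoint_signs_flags : Disjoint signs flags
  disjoint_signs_marks : Disjoint signs marks
  disjoint_flags_marks : Disjoint flags marks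

namespace InputBlocks

variable {n : ℕ} (B : InputBlocks n)

section HardFunction

/-- The excess of ones over zeros among the sign bits, normalized to `[-1, 1]`. -/
noncomputable def signBias (x : Fin n → Bool) : ℝ := 2 * bitAvg B.signs x - 1

/-- The fraction of raised flags. -/
noncomputable def flagRate (x : Fin n → Bool) : ℝ := bitAvg B.flags x

/-- The promise of the hard function: either no flag is raised and the signs are clearly biased or
not, or at least a fraction `r` of the flags is raised and dominates the bias of the signs. -/
def hardDomain (d r : ℝ) : Set (Fin n → Bool) :=
  {x | B.flagRate x = 0 ∧ (B.signBias x ≤ 4 * d ∨ 20 * d ≤ B.signBias x)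
    ∨ r ≤ B.flagRate x ∧ |B.signBias x| ≤ B.flagRate x}

open Classical in
/-- The function separating the two complexities: it asks whether the signs are biased if no flag is
raised, and whether some mark is set otherwise. -/
noncomputable def hardFunction (d r : ℝ) (x : B.hardDomain d r) : Bool :=
  if B.flagRate x = 0 then decide (20 * d ≤ B.signBias x) else decide (∃ j ∈ B.marks, x.1 j = true)

variable {B} {d r : ℝ} {x : Fin n → Bool}

lemma mem_image_hardFunction_false_of_signs (hd : 0 < d) (hx : B.flagRate x = 0)
    (hsign : B.signBias x ≤ 4 * d) : x ∈ Subtype.val '' (B.hardFunction d r ⁻¹' {false}) := by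
  refine ⟨⟨x, Or.inl ⟨hx, Or.inl hsign⟩⟩, ?_, rfl⟩
  simp only [Set.mem_preimage, Set.mem_singleton_iff, hardFunction, if_pos hx,
    decide_eq_false_iff_not]
  linarith

lemma mem_image_hardFunction_true_of_signs (hx : B.flagRate x = 0) (hsign : 20 * d ≤ B.signBias x) :
    x ∈ Subtype.val '' (B.hardFunction d r ⁻¹' {true}) :=
  ⟨⟨x, Or.inl ⟨hx, Or.inr hsign⟩⟩, by simp [hardFunction, hx, hsign], rfl⟩

lemma mem_image_hardFunction_false_of_flags (hr : 0 < r) (hx : r ≤ B.flagRate x)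
    (hsign : |B.signBias x| ≤ B.flagRate x) (hmarks : ∀ j ∈ B.marks, x j = false) :
    x ∈ Subtype.val '' (B.hardFunction d r ⁻¹' {false}) :=
  ⟨⟨x, Or.inr ⟨hx, hsign⟩⟩, by simpa [hardFunction, (hr.trans_le hx).ne'] using hmarks, rfl⟩

lemma mem_image_hardFunction_true_of_flags (hr : 0 < r) (hx : r ≤ B.flagRate x)
    (hsign : |B.signBias x| ≤ B.flagRate x) {j : Fin n} (hj : j ∈ B.marks) (hxj : x j = true) :
    x ∈ Subtype.val '' (B.hardFunction d r ⁻¹' {true}) :=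
  ⟨⟨x, Or.inr ⟨hx, hsign⟩⟩, by simpa [hardFunction, (hr.trans_le hx).ne'] using ⟨j, hj, hxj⟩, rfl⟩

end HardFunction

section Profiles

/-- The bit probabilities giving the signs the bias `a`, the flags the rate `c`, and no marks. -/
noncomputable def profile (a c : ℝ) (i : Fin n) : ℝ :=
  if i ∈ B.signs then (1 + a) / 2 else if i ∈ B.flags then c else 0

/-- The change of bit probabilities that increases the bias of the signs by `p`. -/
noncomputable def tilt (p : ℝ) (i : Fin n) : ℝ := if i ∈ B.signs then p / 2 else 0

lemma profile_add_tilt (a c p : ℝ) : B.profile a c + B.tilt p = B.profile (a + p) c := by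
  ext i
  simp only [Pi.add_apply, profile, tilt]
  split_ifs <;> ring

lemma smul_tilt (k p : ℝ) : k • B.tilt p = B.tilt (k * p) := by
  ext i
  simp only [Pi.smul_apply, smul_eq_mul, tilt]
  split_ifs <;> ring

lemma profile_mem_Icc {a c : ℝ} (ha : a ∈ Set.Icc (-1) 1) (hc : c ∈ Set.Icc 0 1) :
    B.profile a c ∈ Set.Icc 0 1 := by
  obtain ⟨ha₀, ha₁⟩ := ha
  obtain ⟨hc₀, hc₁⟩ := hc
  constructor <;> intro i <;> simp only [profile, Pi.zero_apply, Pi.one_apply] <;> split_ifs <;>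
    linarith

variable {B} {a c : ℝ} {i : Fin n}

lemma profile_of_mem_signs (hi : i ∈ B.signs) : B.profile a c i = (1 + a) / 2 := if_pos hi

lemma profile_of_mem_flags (hi : i ∈ B.flags) : B.profile a c i = c := by
  rw [profile, if_neg (Finset.disjoint_right.1 B.disjoint_signs_flags hi), if_pos hi]

lemma profile_of_mem_marks (hi : i ∈ B.marks) : B.profile a c i = 0 := by
  rw [profile, if_neg (Finset.disjoint_right.1 B.disjoint_signs_marks hi),
    if_neg (Finset.disjoint_right.1 B.disjoint_flags_marks hi)]

lemma tilt_sq_le (hc : c ∈ Set.Icc 0 1) :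
    B.tilt a i ^ 2 ≤ a ^ 2 * (B.profile 0 c i * (1 - B.profile 0 c i)) := by
  have hprofile := B.profile_mem_Icc (a := 0) (by simp) hc
  by_cases hi : i ∈ B.signs
  · rw [tilt, if_pos hi, profile_of_mem_signs hi]
    exact le_of_eq (by ring)
  · rw [tilt, if_neg hi, sq, zero_mul]
    exact mul_nonneg (sq_nonneg a)
      (mul_nonneg (hprofile.1 i) (sub_nonneg.2 (hprofile.2 i)))

lemma abs_profile_sub_profile_le (hc : 0 ≤ c) :
    |B.profile 0 c i - B.profile 0 0 i| ≤ c := by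
  simp only [profile]
  split_ifs <;> simp [abs_of_nonneg, hc]

lemma abs_tilt_le {p : ℝ} (hp : 0 ≤ p) : |B.tilt p i| ≤ p / 2 := by
  have hp2 : 0 ≤ p / 2 := by linarith
  rw [tilt]
  split_ifs
  · exact (abs_of_nonneg hp2).le
  · rwa [abs_zero]

lemma flagRate_eq_zero_of_bitWeight_profile {x : Fin n → Bool}
    (hx : bitWeight (B.profile a 0) x ≠ 0) : B.flagRate x = 0 := by
  rw [flagRate, bitAvg, Finset.sum_eq_zero fun i hi => ?_, zero_div]
  rw [apply_eq_false_of_bitWeight_ne_zero hx (profile_of_mem_flags hi), Bool.toNat_false,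
    Nat.cast_zero]

lemma bitMean_indicator_compl_le {θ : Fin n → ℝ} (hθ : θ ∈ Set.Icc 0 1)
    (hsigns : ∀ i ∈ B.signs, θ i = (1 + a) / 2) (hflags : ∀ i ∈ B.flags, θ i = c)
    {N : ℕ} (hN : 0 < N) (hNsigns : N ≤ B.signs.card) (hNflags : N ≤ B.flags.card) {s : ℝ}
    (hs : 0 < s) {A : Set (Fin n → Bool)}
    (hA : ∀ x, bitWeight θ x ≠ 0 → |B.signBias x - a| < 2 * s → |B.flagRate x - c| < s → x ∈ A) :
    bitMean θ (Aᶜ.indicator 1) ≤ 1 / (2 * s ^ 2 * N) := by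
  have hblock {S : Finset (Fin n)} {q : ℝ} (hS : N ≤ S.card) (hq : ∀ i ∈ S, θ i = q) :
      bitMean θ ({x | s ≤ |bitAvg S x - q|}.indicator 1) ≤ 1 / (4 * s ^ 2 * N) :=
    (bitMean_abs_bitAvg_sub_ge_le hθ (Finset.card_pos.1 (hN.trans_le hS)) hq hs).trans (by gcongr)
  calc bitMean θ (Aᶜ.indicator 1)
      ≤ bitMean θ ({x | s ≤ |bitAvg B.signs x - (1 + a) / 2|}.indicator 1
        + {x | s ≤ |bitAvg B.flags x - c|}.indicator 1) := by
        refine weightedMean_mono (bitWeight_mem_stdSimplex hθ) fun x hx => ?_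
        have htypical (hsign : ¬ s ≤ |bitAvg B.signs x - (1 + a) / 2|)
            (hflag : ¬ s ≤ |bitAvg B.flags x - c|) : x ∈ A := by
          refine hA x hx ?_ (not_le.1 hflag)
          rw [signBias, show 2 * bitAvg B.signs x - 1 - a = 2 * (bitAvg B.signs x - (1 + a) / 2) by
            ring, abs_mul, abs_two]
          linarith
        classical
        simp only [Pi.add_apply, Set.indicator_apply, Set.mem_compl_iff, Set.mem_ofPred_eq,
          Pi.one_apply]
        split_ifs <;> first | tauto | norm_num
    _ ≤ 1 / (4 * s ^ 2 * N) + 1 / (4 * s ^ 2 * N) := by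
        rw [map_add]
        exact add_le_add (hblock hNsigns hsigns) (hblock hNflags hflags)
    _ = 1 / (2 * s ^ 2 * N) := by
        field_simp
        norm_num

variable {d r : ℝ} {N : ℕ} (hN : 0 < N) (hNsigns : N ≤ B.signs.card) (hNflags : N ≤ B.flags.card)
include hN hNsigns hNflags

lemma bitMean_profile_hardFunction_false_of_signs (hd : 0 < d) :
    bitMean (B.profile 0 0) ((Subtype.val '' (B.hardFunction d r ⁻¹' {false}))ᶜ.indicator 1)
      ≤ 1 / (2 * d ^ 2 * N) := by
  refine bitMean_indicator_compl_le (B.profile_mem_Icc (by simp) (by simp))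
    (fun _ => profile_of_mem_signs) (fun _ => profile_of_mem_flags) hN hNsigns hNflags hd
    fun x hx hsign _ => ?_
  refine mem_image_hardFunction_false_of_signs hd (flagRate_eq_zero_of_bitWeight_profile hx) ?_
  linarith [(abs_lt.1 hsign).2]

lemma bitMean_profile_hardFunction_true_of_signs (hd : 0 < d) (hd1 : 40 * d ≤ 1) :
    bitMean (B.profile (40 * d) 0) ((Subtype.val '' (B.hardFunction d r ⁻¹' {true}))ᶜ.indicator 1)
      ≤ 1 / (2 * d ^ 2 * N) := by
  refine bitMean_indicator_compl_le (B.profile_mem_Icc ⟨by linarith, hd1⟩ (by simp))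
    (fun _ => profile_of_mem_signs) (fun _ => profile_of_mem_flags) hN hNsigns hNflags hd
    fun x hx hsign _ => ?_
  refine mem_image_hardFunction_true_of_signs (flagRate_eq_zero_of_bitWeight_profile hx) ?_
  linarith [(abs_lt.1 hsign).1]

lemma bitMean_profile_hardFunction_false_of_flags (hd : 0 < d) (hdr : 3 * d ≤ r) (hr : 2 * r ≤ 1)
    (ha : a ∈ Set.Icc 0 r) :
    bitMean (B.profile a (2 * r)) ((Subtype.val '' (B.hardFunction d r ⁻¹' {false}))ᶜ.indicator 1)
      ≤ 1 / (2 * d ^ 2 * N) := by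
  obtain ⟨ha0, har⟩ := ha
  refine bitMean_indicator_compl_le
    (B.profile_mem_Icc ⟨by linarith, by linarith⟩ ⟨by linarith, hr⟩)
    (fun _ => profile_of_mem_signs) (fun _ => profile_of_mem_flags) hN hNsigns hNflags hd
    fun x hx hsign hflag => ?_
  rw [abs_lt] at hsign hflag
  exact mem_image_hardFunction_false_of_flags (by linarith) (by linarith)
    (abs_le.2 ⟨by linarith, by linarith⟩)
    fun j hj => apply_eq_false_of_bitWeight_ne_zero hx (profile_of_mem_marks hj)

lemma bitMean_update_profile_hardFunction_true (hd : 0 < d) (hdr : 3 * d ≤ r) (hr : 2 * r ≤ 1)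
    {j : Fin n} (hj : j ∈ B.marks) :
    bitMean (Function.update (B.profile 0 (2 * r)) j 1)
      ((Subtype.val '' (B.hardFunction d r ⁻¹' {true}))ᶜ.indicator 1) ≤ 1 / (2 * d ^ 2 * N) := by
  have hjsigns := Finset.disjoint_right.1 B.disjoint_signs_marks hj
  have hjflags := Finset.disjoint_right.1 B.disjoint_flags_marks hj
  refine bitMean_indicator_compl_le (a := 0) (c := 2 * r)
    (update_mem_Icc_zero_one (B.profile_mem_Icc (by simp) ⟨by linarith, hr⟩) j
      unitInterval.one_mem)
    (fun i hi => ?_) (fun i hi => ?_) hN hNsigns hNflags hd fun x hx hsign hflag => ?_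
  · rw [Function.update_of_ne (ne_of_mem_of_not_mem hi hjsigns), profile_of_mem_signs hi]
  · rw [Function.update_of_ne (ne_of_mem_of_not_mem hi hjflags), profile_of_mem_flags hi]
  · rw [abs_lt] at hsign hflag
    exact mem_image_hardFunction_true_of_flags (by linarith) (by linarith)
      (abs_le.2 ⟨by linarith, by linarith⟩) hj
      (apply_eq_true_of_bitWeight_ne_zero hx (Function.update_self ..))

end Profiles

end InputBlocks

section Attainable

variable {n : ℕ} {X : Set (Fin n → Bool)} {f : X → Bool} {s c s' c' : X → ℝ}

/-- The pairs `(s, c)` for which some randomized algorithm computes `f x` with probability at least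
`s x`, and makes at most `c x` queries in expectation, on every input `x`. -/
def attainable (f : X → Bool) : Set ((X → ℝ) × (X → ℝ)) :=
  {v | ∃ R : RandomizedAlgorithm n, ∀ x : X, R.expectedCost x ≠ ∞ ∧
    v.1 x ≤ (R.outputProb x (f x)).toReal ∧ R.queries x ≤ v.2 x}

lemma attainable_of_tree (D : DecisionTree n) (hs : ∀ x : X, s x ≤ if D.eval x = f x then 1 else 0)
    (hc : ∀ x : X, D.cost x ≤ c x) : (s, c) ∈ attainable f := by
  refine ⟨PMF.pure D, fun x => ?_⟩
  simp only [RandomizedAlgorithm.queries, RandomizedAlgorithm.outputProb,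
    RandomizedAlgorithm.expectedCost, tsum_pure_mul, ENNReal.toReal_natCast]
  refine ⟨ENNReal.natCast_ne_top _, (hs x).trans_eq ?_, hc x⟩
  split_ifs <;> simp

lemma attainable_mono (h : (s, c) ∈ attainable f) (hs : s' ≤ s) (hc : c ≤ c') :
    (s', c') ∈ attainable f := by
  obtain ⟨R, hR⟩ := h
  exact ⟨R, fun x => ⟨(hR x).1, (hs x).trans (hR x).2.1, (hR x).2.2.trans (hc x)⟩⟩

lemma convex_attainable (f : X → Bool) : Convex ℝ (attainable f) := by
  rintro ⟨s₁, c₁⟩ ⟨R₁, hR₁⟩ ⟨s₂, c₂⟩ ⟨R₂, hR₂⟩ a b ha hb hab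
  have hmass : ∑' D, (ENNReal.ofReal a * R₁ D + ENNReal.ofReal b * R₂ D) = 1 := by
    rw [ENNReal.tsum_add, ENNReal.tsum_mul_left, ENNReal.tsum_mul_left, R₁.tsum_coe, R₂.tsum_coe,
      mul_one, mul_one, ← ENNReal.ofReal_add ha hb, hab, ENNReal.ofReal_one]
  set R : RandomizedAlgorithm n :=
    ⟨fun D => ENNReal.ofReal a * R₁ D + ENNReal.ofReal b * R₂ D, hmass ▸ ENNReal.summable.hasSum⟩
  have hmix (F : DecisionTree n → ℝ≥0∞) : ∑' D, R D * F D
      = ENNReal.ofReal a * ∑' D, R₁ D * F D + ENNReal.ofReal b * ∑' D, R₂ D * F D := by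
    rw [← ENNReal.tsum_mul_left, ← ENNReal.tsum_mul_left, ← ENNReal.tsum_add]
    exact tsum_congr fun D => by rw [← mul_assoc, ← mul_assoc, ← add_mul]; rfl
  have htoReal {p q : ℝ≥0∞} (hp : p ≠ ∞) (hq : q ≠ ∞) :
      (ENNReal.ofReal a * p + ENNReal.ofReal b * q).toReal = a * p.toReal + b * q.toReal := by
    rw [ENNReal.toReal_add (by finiteness) (by finiteness), ENNReal.toReal_mul, ENNReal.toReal_mul,
      ENNReal.toReal_ofReal ha, ENNReal.toReal_ofReal hb]
  refine ⟨R, fun x => ?_⟩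
  obtain ⟨hfinite₁, hs₁, hc₁⟩ := hR₁ x
  obtain ⟨hfinite₂, hs₂, hc₂⟩ := hR₂ x
  simp only [RandomizedAlgorithm.queries] at hc₁ hc₂ ⊢
  rw [RandomizedAlgorithm.expectedCost, RandomizedAlgorithm.outputProb, hmix, hmix]
  refine ⟨?_, ?_, ?_⟩
  · exact ENNReal.add_ne_top.2 ⟨ENNReal.mul_ne_top ENNReal.ofReal_ne_top hfinite₁,
      ENNReal.mul_ne_top ENNReal.ofReal_ne_top hfinite₂⟩
  · refine le_of_le_of_eq ?_
      (htoReal (R₁.outputProb_ne_top x (f x)) (R₂.outputProb_ne_top x (f x))).symm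
    exact add_le_add (mul_le_mul_of_nonneg_left hs₁ ha) (mul_le_mul_of_nonneg_left hs₂ hb)
  · refine (htoReal hfinite₁ hfinite₂).trans_le ?_
    exact add_le_add (mul_le_mul_of_nonneg_left hc₁ ha) (mul_le_mul_of_nonneg_left hc₂ hb)

lemma attainable_const_one_half : ((fun _ => 1 / 2, 0) : (X → ℝ) × (X → ℝ)) ∈ attainable f := by
  have hleaf (b : Bool) : (((fun x => if b = f x then 1 else 0), 0) : (X → ℝ) × (X → ℝ)) ∈
      attainable f :=
    attainable_of_tree (.leaf b) (fun _ => le_rfl) fun _ => Nat.cast_zero.le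
  refine attainable_mono (convex_attainable f (hleaf false) (hleaf true)
    (a := 1 / 2) (b := 1 / 2) (by norm_num) (by norm_num) (by norm_num)) (fun x => ?_) (by simp)
  cases hx : f x <;> simp [hx]

lemma attainable_bitAvg {S : Finset (Fin n)} (hS : S.Nonempty) {u v a b : X → ℝ}
    (h : ∀ i ∈ S, (fun x => u x + v x * (x.1 i).toNat, fun x => a x + b x * (x.1 i).toNat) ∈
      attainable f) :
    (fun x => u x + v x * bitAvg S x, fun x => a x + b x * bitAvg S x) ∈ attainable f := by
  have hcard : (S.card : ℝ) ≠ 0 := by exact_mod_cast hS.card_ne_zero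
  have hmean (g g' : X → ℝ) (x : X) :
      ∑ i ∈ S, (S.card : ℝ)⁻¹ * (g x + g' x * (x.1 i).toNat) = g x + g' x * bitAvg S x := by
    rw [← Finset.mul_sum, Finset.sum_add_distrib, Finset.sum_const, ← Finset.mul_sum, bitAvg,
      nsmul_eq_mul]
    field_simp
  convert (convex_attainable f).sum_mem (w := fun _ => (S.card : ℝ)⁻¹) (fun _ _ => by positivity)
    (by rw [Finset.sum_const, nsmul_eq_mul, mul_inv_cancel₀ hcard]) h using 1
  ext x
  · simp [Prod.fst_sum, hmean]
  · simp [Prod.snd_sum, hmean]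

lemma distributionalComplexity_le [Fintype X] {μ : PMF X} {γ T : ℝ} (h : (s, c) ∈ attainable f)
    (hs : γ ≤ weightedMean (fun x => (μ x).toReal) s)
    (hc : weightedMean (fun x => (μ x).toReal) c ≤ T) :
    distributionalComplexity f γ μ ≤ ENNReal.ofReal T := by
  obtain ⟨R, hR⟩ := h
  have hμ := toReal_mem_stdSimplex μ
  have hmean {F : X → ℝ≥0∞} (hF : ∀ x, F x ≠ ∞) :
      ∑' x, μ x * F x =
        ENNReal.ofReal (weightedMean (fun x => (μ x).toReal) fun x => (F x).toReal) := by
    rw [weightedMean_apply, ENNReal.ofReal_sum_of_nonneg fun x _ => by positivity, tsum_fintype]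
    refine Finset.sum_congr rfl fun x _ => ?_
    rw [← ENNReal.toReal_mul, ENNReal.ofReal_toReal (ENNReal.mul_ne_top (μ.apply_ne_top x) (hF x))]
  refine (iInf₂_le R ?_).trans ?_
  · rw [RandomizedAlgorithm.distSuccess, hmean fun x => R.outputProb_ne_top x (f x)]
    exact ENNReal.ofReal_le_ofReal (hs.trans (weightedMean_mono hμ fun x _ => (hR x).2.1))
  · rw [RandomizedAlgorithm.distCost, hmean fun x => (hR x).1]
    exact ENNReal.ofReal_le_ofReal ((weightedMean_mono hμ fun x _ => (hR x).2.2).trans hc)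

end Attainable

namespace DecisionTree

variable {n : ℕ}

/-- The tree that queries the listed bits one after the other until it finds one that is `true`, and
outputs whether it has found one. -/
def search : List (Fin n) → DecisionTree n
  | [] => leaf false
  | i :: l => query i (search l) (leaf true)

lemma eval_search (l : List (Fin n)) (x : Fin n → Bool) :
    (search l).eval x = decide (∃ i ∈ l, x i = true) := by
  induction l with
  | nil => simp [search, eval]
  | cons i l ih => cases hi : x i <;> simp [search, eval, ih, hi]

lemma cost_search_le (l : List (Fin n)) (x : Fin n → Bool) : (search l).cost x ≤ l.length := by
  induction l with
  | nil => simp [search, cost]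
  | cons i l ih =>
    simp only [search, cost, List.length_cons]
    split_ifs <;> omega

end DecisionTree

namespace InputBlocks

variable {n : ℕ} {B : InputBlocks n} {d r : ℝ}

section UpperBound

lemma flagRate_ne_zero {x : Fin n → Bool} {i : Fin n} (hi : i ∈ B.flags) (hx : x i = true) :
    B.flagRate x ≠ 0 := by
  have hcard : (0 : ℝ) < B.flags.card := by exact_mod_cast Finset.card_pos.2 ⟨i, hi⟩
  exact (div_pos (Finset.sum_pos' (fun _ _ => by positivity) ⟨i, hi, by simp [hx]⟩) hcard).ne'

lemma attainable_flags (hflags : B.flags.Nonempty) :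
    (fun x => 1 / 2 + 1 / 2 * B.flagRate x.1, fun x => 1 + B.marks.card * B.flagRate x.1) ∈
      attainable (B.hardFunction d r) := by
  refine attainable_bitAvg hflags fun i hi => ?_
  have htree (b : Bool) : (fun x => if x.1 i || (b == B.hardFunction d r x) then (1 : ℝ) else 0,
      fun x => 1 + B.marks.card * ((x.1 i).toNat : ℝ)) ∈ attainable (B.hardFunction d r) := by
    refine attainable_of_tree (.query i (.leaf b) (.search B.marks.toList)) (fun x => ?_)
      fun x => ?_
    · cases hx : x.1 i
      · simp [DecisionTree.eval, hx]
      · simp [DecisionTree.eval, hx, DecisionTree.eval_search, hardFunction, flagRate_ne_zero hi hx]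
    · have hsearch : ((DecisionTree.search B.marks.toList).cost x.1 : ℝ) ≤ B.marks.card := by
        exact_mod_cast B.marks.length_toList ▸ DecisionTree.cost_search_le B.marks.toList x.1
      cases hx : x.1 i
      · simp [DecisionTree.cost, hx]
      · simpa [DecisionTree.cost, hx, add_comm] using hsearch
  refine attainable_mono (convex_attainable _ (htree false) (htree true)
    (a := 1 / 2) (b := 1 / 2) (by norm_num) (by norm_num) (by norm_num)) (fun x => ?_)
    (fun x => le_of_eq ?_)
  · cases hx : x.1 i <;> cases hf : B.hardFunction d r x <;> norm_num [hx, hf]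
  · simp only [Prod.smul_mk, Pi.add_apply, Pi.smul_apply, smul_eq_mul]
    ring

lemma attainable_signs (hsigns : B.signs.Nonempty) :
    (fun x => 1 / 2 + (if B.hardFunction d r x then 1 else -1) * (B.signBias x.1 / 2), 1) ∈
      attainable (B.hardFunction d r) := by
  refine attainable_mono (attainable_bitAvg hsigns (f := B.hardFunction d r)
    (u := fun x => if B.hardFunction d r x then 0 else 1)
    (v := fun x => if B.hardFunction d r x then 1 else -1) (a := 1) (b := 0) fun i _ => ?_)
    (fun x => ?_) fun x => by simp
  · refine attainable_of_tree (.query i (.leaf false) (.leaf true)) (fun x => ?_) fun x => ?_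
    · cases hx : x.1 i <;> cases hf : B.hardFunction d r x <;> simp [DecisionTree.eval, hx]
    · simp [DecisionTree.cost]
  · rw [signBias]
    dsimp only
    split_ifs <;> linarith

lemma attainable_leaf_false :
    (fun x => if B.hardFunction d r x then (0 : ℝ) else 1, 0) ∈ attainable (B.hardFunction d r) :=
  attainable_of_tree (.leaf false)
    (fun x => by cases hf : B.hardFunction d r x <;> simp [DecisionTree.eval])
    fun _ => Nat.cast_zero.le

variable [Fintype (B.hardDomain d r)] {μ : PMF (B.hardDomain d r)}

lemma distributionalComplexity_hardFunction_le_of_flags (hflags : B.flags.Nonempty) (hd : 0 < d)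
    (hμ : d ≤ weightedMean (fun x => (μ x).toReal) fun x => B.flagRate x.1) :
    distributionalComplexity (B.hardFunction d r) ((1 + d) / 2) μ
      ≤ ENNReal.ofReal (1 + d * B.marks.card) := by
  set Φ := weightedMean (fun x => (μ x).toReal) fun x => B.flagRate x.1
  have hΦ : 0 < Φ := hd.trans_le hμ
  have hΦ1 : d / Φ ≤ 1 := (div_le_one hΦ).2 hμ
  have hmean (u v : ℝ) : weightedMean (fun x => (μ x).toReal) (fun x => u + v * B.flagRate x.1)
      = u + v * Φ := by
    have : (fun x : B.hardDomain d r => u + v * B.flagRate x.1)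
        = (fun _ => u) + v • fun x => B.flagRate x.1 := rfl
    rw [this, map_add, map_smul, weightedMean_const (toReal_mem_stdSimplex μ), smul_eq_mul]
  -- The flags are consulted just often enough for the success probability to be `(1 + d) / 2`.
  have hmix := convex_attainable (B.hardFunction d r) (attainable_flags hflags)
    attainable_const_one_half (a := d / Φ) (b := 1 - d / Φ) (by positivity) (by linarith) (by ring)
  refine distributionalComplexity_le (attainable_mono hmix
    (s' := fun x => 1 / 2 + d / Φ / 2 * B.flagRate x.1)
    (c' := fun x => d / Φ + d / Φ * B.marks.card * B.flagRate x.1)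
    (fun x => le_of_eq ?_) fun x => le_of_eq ?_) ?_ ?_
  · simp only [Prod.smul_mk, Pi.add_apply, Pi.smul_apply, smul_eq_mul]
    ring
  · simp only [Prod.smul_mk, Pi.add_apply, Pi.smul_apply, smul_eq_mul, Pi.zero_apply]
    ring
  · rw [hmean]
    exact le_of_eq (by field_simp)
  · rw [hmean, show d / Φ * B.marks.card * Φ = d * B.marks.card by field_simp]
    linarith

lemma distributionalComplexity_hardFunction_le_of_signs (hsigns : B.signs.Nonempty) (hd : 0 < d)
    (hr : 0 < r) (hμ : weightedMean (fun x => (μ x).toReal) (fun x => B.flagRate x.1) ≤ d)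
    (hμsigns : 1 / 4 ≤ weightedMean (fun x => (μ x).toReal)
      ({x | B.flagRate x.1 = 0 ∧ B.hardFunction d r x}.indicator 1)) :
    distributionalComplexity (B.hardFunction d r) ((1 + d) / 2) μ ≤ ENNReal.ofReal 1 := by
  have hsimplex := toReal_mem_stdSimplex μ
  refine distributionalComplexity_le (attainable_mono (attainable_signs hsigns)
    (s' := (fun _ => 1 / 2 - 2 * d) + (12 * d) •
      {x : B.hardDomain d r | B.flagRate x.1 = 0 ∧ B.hardFunction d r x}.indicator 1
      + (-1 / 2 : ℝ) • fun x => B.flagRate x.1) (fun x => ?_) le_rfl) ?_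
    (weightedMean_const hsimplex 1).le
  · simp only [Pi.add_apply, Pi.smul_apply, smul_eq_mul]
    rcases x.2 with ⟨h0, hsign⟩ | ⟨hflag, hsign⟩
    · by_cases h20 : 20 * d ≤ B.signBias x.1
      · have hf : B.hardFunction d r x = true := by simp [hardFunction, h0, h20]
        simp only [hf, h0, Set.indicator_apply, Set.mem_ofPred_eq, true_and, if_true, Pi.one_apply]
        linarith
      · have hf : B.hardFunction d r x = false := by simp [hardFunction, h0, h20]
        simp only [hf, h0, Set.indicator_apply, Set.mem_ofPred_eq, Bool.false_eq_true, and_false,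
          if_false]
        linarith [hsign.resolve_right h20]
    · simp only [(hr.trans_le hflag).ne', Set.indicator_apply, Set.mem_ofPred_eq, false_and,
        if_false]
      split_ifs <;> linarith [abs_le.1 hsign]
  · rw [map_add, map_add, map_smul, map_smul, weightedMean_const hsimplex, smul_eq_mul, smul_eq_mul]
    nlinarith

lemma distributionalComplexity_hardFunction_le_of_leaf (hd : d ≤ 1 / 4) (hr : 0 < r)
    (hdr : 8 * d ≤ r) (hμ : weightedMean (fun x => (μ x).toReal) (fun x => B.flagRate x.1) ≤ d)
    (hμsigns : weightedMean (fun x => (μ x).toReal)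
      ({x | B.flagRate x.1 = 0 ∧ B.hardFunction d r x}.indicator 1) ≤ 1 / 4) :
    distributionalComplexity (B.hardFunction d r) ((1 + d) / 2) μ ≤ ENNReal.ofReal 0 := by
  refine distributionalComplexity_le (attainable_mono attainable_leaf_false
    (s' := (fun _ => 1) -
      {x : B.hardDomain d r | B.flagRate x.1 = 0 ∧ B.hardFunction d r x}.indicator 1
      - r⁻¹ • fun x => B.flagRate x.1) (fun x => ?_) le_rfl) ?_ (map_zero _).le
  · simp only [Pi.sub_apply, Pi.smul_apply, smul_eq_mul, Set.indicator_apply, Set.mem_ofPred_eq,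
      Pi.one_apply]
    rcases x.2 with ⟨h0, -⟩ | ⟨hflag, -⟩
    · cases hf : B.hardFunction d r x <;> simp [h0]
    · have hrate : 1 ≤ r⁻¹ * B.flagRate x.1 := by rwa [← div_eq_inv_mul, one_le_div₀ hr]
      split_ifs <;> linarith
  · have hrate : r⁻¹ * weightedMean (fun x => (μ x).toReal) (fun x => B.flagRate x.1) ≤ 1 / 8 := by
      rw [← div_eq_inv_mul, div_le_iff₀ hr]
      linarith
    rw [map_sub, map_sub, map_smul, weightedMean_const (toReal_mem_stdSimplex μ), smul_eq_mul]
    linarith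

end UpperBound

theorem maxDistributionalComplexity_hardFunction_le (hsigns : B.signs.Nonempty)
    (hflags : B.flags.Nonempty) (hd : 0 < d) (hd4 : d ≤ 1 / 4) (hdr : 8 * d ≤ r) :
    maxDistributionalComplexity (B.hardFunction d r) ((1 + d) / 2)
      ≤ ENNReal.ofReal (1 + d * B.marks.card) := by
  have := Fintype.ofFinite (B.hardDomain d r)
  have hr : 0 < r := by linarith
  have hcost : 0 ≤ d * B.marks.card := by positivity
  refine iSup_le fun μ => ?_
  rcases le_total d (weightedMean (fun x => (μ x).toReal) fun x => B.flagRate x.1) with hμ | hμ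
  · exact distributionalComplexity_hardFunction_le_of_flags hflags hd hμ
  rcases le_total (1 / 4) (weightedMean (fun x => (μ x).toReal)
    ({x | B.flagRate x.1 = 0 ∧ B.hardFunction d r x}.indicator 1)) with hμsigns | hμsigns
  · exact (distributionalComplexity_hardFunction_le_of_signs hsigns hd hr hμ hμsigns).trans
      (ENNReal.ofReal_le_ofReal (by linarith))
  · exact (distributionalComplexity_hardFunction_le_of_leaf hd4 hr hdr hμ hμsigns).trans
      (ENNReal.ofReal_le_ofReal (by linarith))

lemma hardFunction_surjective (hsigns : B.signs.Nonempty) (hd : 0 < d) (hd1 : 20 * d ≤ 1) :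
    Function.Surjective (B.hardFunction d r) := by
  have hcard : (B.signs.card : ℝ) ≠ 0 := by exact_mod_cast hsigns.card_ne_zero
  have hfalse := mem_image_hardFunction_false_of_signs (B := B) (r := r) (x := fun _ => false) hd
    (by simp [flagRate, bitAvg]) (by norm_num [signBias, bitAvg]; linarith)
  have hsign : B.signBias (fun i => decide (i ∈ B.signs)) = 1 := by
    rw [signBias, bitAvg, Finset.sum_congr rfl (g := fun _ => (1 : ℝ)) fun i hi => by simp [hi],
      Finset.sum_const, nsmul_eq_mul, mul_one, div_self hcard]
    norm_num
  have hflag : B.flagRate (fun i => decide (i ∈ B.signs)) = 0 := by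
    rw [flagRate, bitAvg, Finset.sum_eq_zero fun i hi => ?_, zero_div]
    simp [Finset.disjoint_right.1 B.disjoint_signs_flags hi]
  have htrue := mem_image_hardFunction_true_of_signs (r := r) hflag (hd1.trans hsign.ge)
  rintro (_ | _)
  · exact hfalse.imp fun _ h => h.1
  · exact htrue.imp fun _ h => h.1

end InputBlocks

namespace InputBlocks

variable {n : ℕ} {B : InputBlocks n} {R : RandomizedAlgorithm n} {k m M N : ℕ} {d T : ℝ}

lemma mul_half_le_of_worstSuccess_hardFunction (hN : 0 < N) (hNsigns : N ≤ B.signs.card)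
    (hNflags : N ≤ B.flags.card) (hmarks : B.marks.Nonempty) (hk : 0 < k) (hm : 0 < m) (hM : 0 < M)
    (hT : 0 ≤ T) (hd : 0 < d) (hkd : 80 * (k * d) ≤ 1) (hkm : k * (40 * d) * m ≤ 1)
    (hε : 1 / (2 * d ^ 2 * N) ≤ d / 10) (hMε : M * (1 / (2 * d ^ 2 * N)) ≤ T)
    (hTM : T / M ≤ d / 10)
    (hR : ENNReal.ofReal ((1 + d) / 2) ≤ R.worstSuccess (B.hardFunction d (40 * (k * d))))
    (hRT : R.worstExpectedCost (B.hardDomain d (40 * (k * d))) ≤ ENNReal.ofReal T) :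
    k * d / 2 ≤ 2 * T / B.marks.card
      + k * (2 * (20 * d) * (80 * (k * d) + k * (20 * d)) * m ^ 4)
      + k * (40 * d) / m * (8 * T) := by
  have hk1 : (1 : ℝ) ≤ k := by exact_mod_cast hk
  have hdk : d ≤ k * d := le_mul_of_one_le_left hd.le hk1
  have hθη : B.profile 0 0 + B.tilt (40 * d) = B.profile (40 * d) 0 := by
    rw [profile_add_tilt, zero_add]
  have hθ'η : B.profile 0 (2 * (40 * (k * d))) + (k : ℝ) • B.tilt (40 * d)
      = B.profile (40 * (k * d)) (2 * (40 * (k * d))) := by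
    rw [smul_tilt, profile_add_tilt, zero_add, mul_left_comm]
  have hflags : 2 * (40 * (k * d)) ∈ Set.Icc (0 : ℝ) 1 := ⟨by positivity, by linarith⟩
  have hθ0 := B.profile_mem_Icc (a := 0) (c := 0) (by simp) (by simp)
  refine mul_half_le_of_worstSuccess hk hm hM hT (by linarith) hmarks hε hMε hTM
    (θ := B.profile 0 0) (θ' := B.profile 0 (2 * (40 * (k * d)))) (η := B.tilt (40 * d))
    hθ0 ?_ (B.profile_mem_Icc (by simp) hflags) ?_ (by positivity) (by positivity) (fun i => ?_)
    (fun i => ?_) (by positivity) hkm (fun _ => tilt_sq_le (by simp))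
    (fun _ => tilt_sq_le hflags)
    (bitMean_profile_hardFunction_false_of_signs hN hNsigns hNflags hd) ?_
    (bitMean_profile_hardFunction_false_of_flags hN hNsigns hNflags hd (by linarith) hflags.2
      ⟨le_rfl, by positivity⟩) ?_
    (fun j => bitMean_update_profile_hardFunction_true hN hNsigns hNflags hd (by linarith) hflags.2)
    hR hRT
  · rw [hθη]
    exact B.profile_mem_Icc ⟨by linarith, by linarith⟩ (by simp)
  · rw [hθ'η]
    exact B.profile_mem_Icc ⟨by linarith, by linarith⟩ hflags
  · exact (abs_tilt_le (by positivity)).trans (by linarith)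
  · exact (abs_profile_sub_profile_le hflags.1).trans (by linarith)
  · rw [hθη]
    exact bitMean_profile_hardFunction_true_of_signs hN hNsigns hNflags hd (by linarith)
  · rw [hθ'η]
    exact bitMean_profile_hardFunction_false_of_flags hN hNsigns hNflags hd (by linarith) hflags.2
      ⟨by positivity, le_rfl⟩

theorem le_averageCaseComplexity_hardFunction (hN : 0 < N) (hNsigns : N ≤ B.signs.card)
    (hNflags : N ≤ B.flags.card) (hd : 0 < d) (hT : 0 < T) (hkT : 16 * T ≤ k) (hmT : 2560 * T ≤ m)
    (hkm : 32000 * (k * d) * m ^ 4 ≤ 1) (hmarks : 1 ≤ d * B.marks.card)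
    (hε : 1 / (2 * d ^ 2 * N) ≤ d / 10) (hMε : M * (1 / (2 * d ^ 2 * N)) ≤ T)
    (hTM : T ≤ d / 10 * M) :
    ENNReal.ofReal T ≤ averageCaseComplexity (B.hardFunction d (40 * (k * d))) ((1 + d) / 2) := by
  refine le_iInf₂ fun R hR => le_of_not_gt fun hRT => ?_
  have hk : (0 : ℝ) < k := by linarith
  have hm : (0 : ℝ) < m := by linarith
  have hM : (0 : ℝ) < M := pos_of_mul_pos_right (hT.trans_le hTM) (by positivity)
  have hcard : (0 : ℝ) < B.marks.card := pos_of_mul_pos_right (one_pos.trans_le hmarks) hd.le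
  have hkd : 0 < k * d := by positivity
  have hm1 : (1 : ℝ) ≤ m := Nat.one_le_cast.2 (Nat.cast_pos.1 hm)
  have hm4 : (m : ℝ) ≤ m ^ 4 := le_self_pow₀ hm1 (by norm_num)
  have hkdm : 32000 * (k * d) * m ≤ 1 := le_trans (by gcongr) hkm
  have hkd1 : 32000 * (k * d) ≤ 1 := (le_mul_of_one_le_right (by positivity) hm1).trans hkdm
  have h := mul_half_le_of_worstSuccess_hardFunction hN hNsigns hNflags
    (Finset.card_pos.1 (Nat.cast_pos.1 hcard)) (Nat.cast_pos.1 hk) (Nat.cast_pos.1 hm)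
    (Nat.cast_pos.1 hM) hT.le hd (by linarith) (by nlinarith) hε hMε ((div_le_iff₀ hM).2 hTM) hR
    hRT.le
  have hsearch : 2 * T / B.marks.card ≤ k * d / 8 := by
    rw [div_le_iff₀ hcard]
    nlinarith
  have hcurvature : k * (2 * (20 * d) * (80 * (k * d) + k * (20 * d)) * m ^ 4) ≤ k * d / 8 := by
    calc k * (2 * (20 * d) * (80 * (k * d) + k * (20 * d)) * m ^ 4)
        = 32000 * (k * d) * m ^ 4 * (k * d / 8) := by ring
      _ ≤ k * d / 8 := mul_le_of_le_one_left (by positivity) hkm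
  have hlate : k * (40 * d) / m * (8 * T) ≤ k * d / 8 := by
    rw [div_mul_eq_mul_div, div_le_iff₀ hm]
    nlinarith
  linarith

lemma exists_le_averageCaseComplexity_hardFunction {t : ℝ} (ht : 10 ^ 21 ≤ t)
    (hsigns : t ^ 20 ≤ B.signs.card) (hflags : t ^ 20 ≤ B.flags.card)
    (hmarks : t ^ 6 ≤ B.marks.card) :
    ∃ k : ℕ, 1 ≤ k ∧ ENNReal.ofReal t ≤
      averageCaseComplexity (B.hardFunction (1 / t ^ 6) (40 * (k * (1 / t ^ 6))))
        ((1 + 1 / t ^ 6) / 2) := by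
  have ht0 : 0 < t := by linarith
  have ht2 : 10 ≤ t ^ 2 := by nlinarith
  have ht7 : 1 ≤ t ^ 7 := one_le_pow₀ (by linarith)
  have hk : (⌈16 * t⌉₊ : ℝ) ≤ 17 * t :=
    (Nat.ceil_lt_add_one (by positivity)).le.trans (by linarith)
  have hm : (⌈2560 * t⌉₊ : ℝ) ≤ 2561 * t :=
    (Nat.ceil_lt_add_one (by positivity)).le.trans (by linarith)
  have hM : (⌈10 * t ^ 7⌉₊ : ℝ) ≤ 11 * t ^ 7 :=
    (Nat.ceil_lt_add_one (by positivity)).le.trans (by linarith)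
  have hε : 1 / (2 * (1 / t ^ 6) ^ 2 * (⌈t ^ 20⌉₊ : ℝ)) ≤ 1 / (2 * t ^ 8) := by
    calc 1 / (2 * (1 / t ^ 6) ^ 2 * (⌈t ^ 20⌉₊ : ℝ)) ≤ 1 / (2 * (1 / t ^ 6) ^ 2 * t ^ 20) := by
          gcongr
          exact Nat.le_ceil _
      _ = 1 / (2 * t ^ 8) := by field_simp
  refine ⟨⌈16 * t⌉₊, Nat.one_le_ceil_iff.2 (by positivity),
    le_averageCaseComplexity_hardFunction (m := ⌈2560 * t⌉₊) (M := ⌈10 * t ^ 7⌉₊) (N := ⌈t ^ 20⌉₊)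
      (Nat.ceil_pos.2 (by positivity)) (Nat.ceil_le.2 hsigns) (Nat.ceil_le.2 hflags)
      (by positivity) ht0 (Nat.le_ceil _) (Nat.le_ceil _) ?_ ?_ (hε.trans ?_) ?_ ?_⟩
  · calc 32000 * (⌈16 * t⌉₊ * (1 / t ^ 6)) * (⌈2560 * t⌉₊ : ℝ) ^ 4
        ≤ 32000 * (17 * t * (1 / t ^ 6)) * (2561 * t) ^ 4 := by gcongr
      _ = 32000 * 17 * 2561 ^ 4 / t := by field_simp
      _ ≤ 1 := (div_le_one ht0).2 (by linarith)
  · rwa [one_div_mul_eq_div, one_le_div₀ (by positivity)]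
  · rw [div_div]
    refine one_div_le_one_div_of_le (by positivity) ?_
    nlinarith [pow_pos ht0 6]
  · calc ⌈10 * t ^ 7⌉₊ * (1 / (2 * (1 / t ^ 6) ^ 2 * (⌈t ^ 20⌉₊ : ℝ)))
        ≤ 11 * t ^ 7 * (1 / (2 * t ^ 8)) := by gcongr
      _ = 11 / (2 * t) := by field_simp
      _ ≤ t := by
        rw [div_le_iff₀ (by positivity)]
        nlinarith
  · calc t = 1 / t ^ 6 / 10 * (10 * t ^ 7) := by field_simp
      _ ≤ 1 / t ^ 6 / 10 * ⌈10 * t ^ 7⌉₊ := by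
        gcongr
        exact Nat.le_ceil _

lemma exists_card_eq {K : ℕ} (h : 2 * N + K ≤ n) :
    ∃ B : InputBlocks n, B.signs.card = N ∧ B.flags.card = N ∧ B.marks.card = K := by
  obtain ⟨signs, -, hsigns⟩ := Finset.exists_subset_card_eq
    (s := (Finset.univ : Finset (Fin n))) (n := N) (by simp; omega)
  obtain ⟨flags, hflags_sub, hflags⟩ := Finset.exists_subset_card_eq (s := signsᶜ) (n := N)
    (by simp [Finset.card_compl, hsigns]; omega)
  have hdisj : Disjoint signs flags := Finset.subset_compl_iff_disjoint_left.1 hflags_sub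
  obtain ⟨marks, hmarks_sub, hmarks⟩ := Finset.exists_subset_card_eq
    (s := (signs ∪ flags)ᶜ) (n := K)
    (by rw [Finset.card_compl, Finset.card_union_of_disjoint hdisj, Fintype.card_fin]; omega)
  obtain ⟨hsigns_marks, hflags_marks⟩ := Finset.disjoint_union_left.1
    (Finset.subset_compl_iff_disjoint_left.1 hmarks_sub)
  exact ⟨⟨signs, flags, marks, hdisj, hsigns_marks, hflags_marks⟩, hsigns, hflags, hmarks⟩

end InputBlocks

theorem exists_separation {n : ℕ} {d t : ℝ} (ht : 10 ^ 21 ≤ t) (hdt : d * t ^ 6 = 1)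
    (hn : t ^ 24 ≤ n) :
    ∃ (X : Set (Fin n → Bool)) (f : X → Bool), Function.Surjective f ∧
      maxDistributionalComplexity f ((1 + d) / 2) ≤ ENNReal.ofReal 3 ∧
      ENNReal.ofReal t ≤ averageCaseComplexity f ((1 + d) / 2) := by
  have ht1 : 1 ≤ t := by linarith
  have ht6 : 40 ≤ t ^ 6 := by linarith [le_self_pow₀ ht1 (n := 6) (by norm_num)]
  have hsize : 2 * ⌈t ^ 20⌉₊ + ⌈t ^ 6⌉₊ ≤ n := by
    have h20 := (Nat.ceil_lt_add_one (show 0 ≤ t ^ 20 by positivity)).le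
    have h6 := (Nat.ceil_lt_add_one (show 0 ≤ t ^ 6 by positivity)).le
    have h6_20 : t ^ 6 ≤ t ^ 20 := pow_le_pow_right₀ ht1 (by norm_num)
    have h20_24 : 10 * t ^ 20 ≤ t ^ 24 := by
      rw [show t ^ 24 = t ^ 4 * t ^ 20 by ring]
      gcongr
      linarith [le_self_pow₀ ht1 (n := 4) (by norm_num)]
    exact_mod_cast show (2 * ⌈t ^ 20⌉₊ + ⌈t ^ 6⌉₊ : ℝ) ≤ n by linarith
  obtain ⟨B, hsigns, hflags, hmarks⟩ := InputBlocks.exists_card_eq hsize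
  have hN : 0 < ⌈t ^ 20⌉₊ := Nat.ceil_pos.2 (by positivity)
  have hBsigns : B.signs.Nonempty := Finset.card_pos.1 (hsigns ▸ hN)
  have hBflags : B.flags.Nonempty := Finset.card_pos.1 (hflags ▸ hN)
  obtain rfl : d = 1 / t ^ 6 := eq_one_div_of_mul_eq_one_left hdt
  obtain ⟨k, hk, havg⟩ := B.exists_le_averageCaseComplexity_hardFunction ht
    (hsigns ▸ Nat.le_ceil _) (hflags ▸ Nat.le_ceil _) (hmarks ▸ Nat.le_ceil _)
  have hd : 0 < 1 / t ^ 6 := by positivity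
  have hd40 : 1 / t ^ 6 ≤ 1 / 40 := by gcongr
  have hdk : 1 / t ^ 6 ≤ k * (1 / t ^ 6) :=
    le_mul_of_one_le_left hd.le (by exact_mod_cast hk)
  refine ⟨_, B.hardFunction (1 / t ^ 6) (40 * (k * (1 / t ^ 6))),
    InputBlocks.hardFunction_surjective hBsigns hd (by linarith),
    (InputBlocks.maxDistributionalComplexity_hardFunction_le hBsigns hBflags hd (by linarith)
      (by linarith)).trans (ENNReal.ofReal_le_ofReal ?_), havg⟩
  have hK : (B.marks.card : ℝ) ≤ 2 * t ^ 6 := by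
    rw [hmarks]
    linarith [(Nat.ceil_lt_add_one (show 0 ≤ t ^ 6 by positivity)).le]
  calc 1 + 1 / t ^ 6 * B.marks.card ≤ 1 + 1 / t ^ 6 * (2 * t ^ 6) := by gcongr
    _ = 3 := by
      field_simp
      norm_num

section Dictator

variable {n : ℕ}

/-- The total function that reads off the bit `i`. -/
def dictator (i : Fin n) (x : (Set.univ : Set (Fin n → Bool))) : Bool := x.1 i

lemma dictator_surjective (i : Fin n) : Function.Surjective (dictator i) :=
  fun b => ⟨⟨fun _ => b, trivial⟩, rfl⟩

lemma maxDistributionalComplexity_dictator_le (i : Fin n) {γ : ℝ} (hγ : γ ≤ 1) :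
    maxDistributionalComplexity (dictator i) γ ≤ ENNReal.ofReal 1 := by
  refine iSup_le fun μ => ?_
  have htree : (1, 1) ∈ attainable (dictator i) := by
    refine attainable_of_tree (.query i (.leaf false) (.leaf true)) (fun x => ?_) fun x => ?_
    · cases hx : x.1 i <;> simp [DecisionTree.eval, dictator, hx]
    · simp [DecisionTree.cost]
  have hmean := weightedMean_const (toReal_mem_stdSimplex μ) 1
  exact distributionalComplexity_le htree (hγ.trans hmean.ge) hmean.le

end Dictator

section Sensitivity

variable {n : ℕ} {x : Fin n → Bool}

lemma DecisionTree.accept_sub_accept_le_cost (D : DecisionTree n) (x y : Fin n → Bool) :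
    D.accept y - D.accept x ≤ D.cost x := by
  cases D with
  | leaf b => simp [accept, eval, cost]
  | query i t₀ t₁ =>
    have hcost : (1 : ℝ) ≤ (query i t₀ t₁).cost x := by exact_mod_cast Nat.le_add_left 1 _
    linarith [accept_le_one (query i t₀ t₁) y, accept_nonneg (query i t₀ t₁) x]

lemma RandomizedAlgorithm.accept_sub_accept_le_queries (R : RandomizedAlgorithm n)
    (hx : R.expectedCost x ≠ ∞) (y : Fin n → Bool) : R.accept y - R.accept x ≤ R.queries x := by
  have haccept := Pi.hasSum.1 R.hasSum_smul_accept
  refine hasSum_le (fun D => ?_) ((haccept y).sub (haccept x)) (hasSum_toReal_mul_toReal R hx)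
  rw [Pi.smul_apply, Pi.smul_apply, ← smul_sub, smul_eq_mul, ENNReal.toReal_natCast]
  exact mul_le_mul_of_nonneg_left (D.accept_sub_accept_le_cost x y) ENNReal.toReal_nonneg

lemma ofReal_le_averageCaseComplexity_of_surjective {X : Set (Fin n → Bool)} {f : X → Bool}
    (hf : Function.Surjective f) (d : ℝ) :
    ENNReal.ofReal d ≤ averageCaseComplexity f ((1 + d) / 2) := by
  refine le_iInf₂ fun R hR => ?_
  obtain ⟨x, hx⟩ := hf false
  obtain ⟨y, hy⟩ := hf true
  refine le_trans ?_ (le_iSup (fun z : X => R.expectedCost z) x)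
  rcases eq_or_ne (R.expectedCost x) ∞ with htop | htop
  · exact htop ▸ le_top
  have hreject := RandomizedAlgorithm.le_toReal_outputProb hR x
  rw [hx, RandomizedAlgorithm.toReal_outputProb_false] at hreject
  have haccept := RandomizedAlgorithm.le_toReal_outputProb hR y
  rw [hy] at haccept
  change (1 + d) / 2 ≤ R.accept y at haccept
  refine ENNReal.ofReal_le_of_le_toReal (le_trans ?_ (R.accept_sub_accept_le_queries htop y))
  linarith

end Sensitivity

section Constants

variable {n : ℕ} {δ s : ℝ}

lemma exists_maxDistributionalComplexity_le_of_small (hs0 : 0 < s) (hs : s ≤ 1 / 10 ^ 21)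
    (hs6 : s ^ 6 = δ) (hn : s⁻¹ ^ 24 ≤ n) :
    ∃ (X : Set (Fin n → Bool)) (f : X → Bool), Function.Surjective f ∧
      maxDistributionalComplexity f ((1 + δ) / 2) ≤
        ENNReal.ofReal ((10 ^ 21) ^ 12 * s) * averageCaseComplexity f ((1 + δ) / 2) := by
  obtain ⟨X, f, hf, hmax, havg⟩ := exists_separation (d := δ) (t := s⁻¹)
    (by rw [le_inv_comm₀ (by positivity) hs0, ← one_div]; exact hs)
    (by rw [← hs6, inv_pow]; exact mul_inv_cancel₀ (by positivity)) hn
  refine ⟨X, f, hf, ?_⟩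
  calc maxDistributionalComplexity f ((1 + δ) / 2) ≤ ENNReal.ofReal 3 := hmax
    _ ≤ ENNReal.ofReal ((10 ^ 21) ^ 12 * s * s⁻¹) := by
        refine ENNReal.ofReal_le_ofReal ?_
        rw [mul_assoc, mul_inv_cancel₀ hs0.ne']
        norm_num
    _ = ENNReal.ofReal ((10 ^ 21) ^ 12 * s) * ENNReal.ofReal s⁻¹ :=
        ENNReal.ofReal_mul (by positivity)
    _ ≤ _ := by gcongr

lemma exists_maxDistributionalComplexity_le_of_large (hn : 0 < n) (hs : 1 / 10 ^ 21 ≤ s)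
    (hs6 : s ^ 6 = δ) (hδ1 : δ ≤ 1) :
    ∃ (X : Set (Fin n → Bool)) (f : X → Bool), Function.Surjective f ∧
      maxDistributionalComplexity f ((1 + δ) / 2) ≤
        ENNReal.ofReal ((10 ^ 21) ^ 12 * s) * averageCaseComplexity f ((1 + δ) / 2) := by
  have hs0 : 0 < s := by linarith
  have hs1 : s ≤ 1 := (pow_le_one_iff_of_nonneg hs0.le (by norm_num)).1 (hs6.le.trans hδ1)
  have hsurjective := dictator_surjective (⟨0, hn⟩ : Fin n)
  refine ⟨_, _, hsurjective, ?_⟩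
  calc maxDistributionalComplexity (dictator ⟨0, hn⟩) ((1 + δ) / 2) ≤ ENNReal.ofReal 1 :=
        maxDistributionalComplexity_dictator_le _ (by linarith)
    _ ≤ ENNReal.ofReal ((10 ^ 21) ^ 12 * s * δ) := by
        refine ENNReal.ofReal_le_ofReal ?_
        calc (1 : ℝ) ≤ (10 ^ 21 * s) ^ 12 := one_le_pow₀ (by linarith)
          _ = (10 ^ 21) ^ 12 * s ^ 12 := mul_pow _ _ _
          _ ≤ (10 ^ 21) ^ 12 * s ^ 7 :=
            mul_le_mul_of_nonneg_left (pow_le_pow_of_le_one hs0.le hs1 (by norm_num))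
              (by positivity)
          _ = (10 ^ 21) ^ 12 * s * δ := by rw [← hs6]; ring
    _ = ENNReal.ofReal ((10 ^ 21) ^ 12 * s) * ENNReal.ofReal δ := ENNReal.ofReal_mul (by positivity)
    _ ≤ _ := by
        gcongr
        exact ofReal_le_averageCaseComplexity_of_surjective hsurjective δ

lemma inv_pow_le_natCast_of_rpow_neg_le (hn : 0 < n) (hs6 : s ^ 6 = δ)
    (hδ : (n : ℝ) ^ (-(1 / 4) : ℝ) ≤ δ) : s⁻¹ ^ 24 ≤ n := by
  have hn0 : (0 : ℝ) < n := by exact_mod_cast hn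
  have hinv : (n : ℝ)⁻¹ ≤ δ ^ 4 := by
    calc (n : ℝ)⁻¹ = ((n : ℝ) ^ (-(1 / 4) : ℝ)) ^ 4 := by
          rw [← Real.rpow_mul_natCast hn0.le, ← Real.rpow_neg_one]
          norm_num
      _ ≤ δ ^ 4 := by gcongr
  calc s⁻¹ ^ 24 = (δ ^ 4)⁻¹ := by rw [← hs6, inv_pow, ← pow_mul]
    _ ≤ n := inv_le_of_inv_le₀ hn0 hinv

end Constants

theorem mainTheorem10 :
    ∃ C c : ℝ, 0 < C ∧ 0 < c ∧
      ∀ n : ℕ, 1 ≤ n → ∀ δ : ℝ, (n : ℝ) ^ (-c) ≤ δ → δ ≤ 1 →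
        ∃ (X : Set (Fin n → Bool)) (f : X → Bool),
          Function.Surjective f ∧
          maxDistributionalComplexity f ((1 + δ) / 2) ≤
            ENNReal.ofReal (C * δ ^ (1 / 6 : ℝ)) * averageCaseComplexity f ((1 + δ) / 2) := by
  refine ⟨(10 ^ 21) ^ 12, 1 / 4, by positivity, by norm_num, fun n hn δ hδ hδ1 => ?_⟩
  have hδ0 : 0 < δ := (Real.rpow_pos_of_pos (by exact_mod_cast hn) _).trans_le hδ
  have hs0 : 0 < δ ^ (1 / 6 : ℝ) := Real.rpow_pos_of_pos hδ0 _
  have hs6 : (δ ^ (1 / 6 : ℝ)) ^ 6 = δ := by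
    rw [← Real.rpow_mul_natCast hδ0.le]
    norm_num
  rcases le_total (δ ^ (1 / 6 : ℝ)) (1 / 10 ^ 21) with hs | hs
  · exact exists_maxDistributionalComplexity_le_of_small hs0 hs hs6
      (inv_pow_le_natCast_of_rpow_neg_le hn hs6 hδ)
  · exact exists_maxDistributionalComplexity_le_of_large hn hs hs6 hδ1
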